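/- Let $b$ be a smooth axisymmetric vector field on $\mathbb R^3$ of the form $b=b^\theta(r,z)\,e_\theta$, that is, $R_{-\alpha}\,b(R_\alpha x)=b(x)$ for every rotation $R_\alpha$ about the vertical axis, with trivial radial and vertical components $b^r=0$ and $b^z=0$; here $(r,\theta,z)$ are cylindrical coordinates, with basis $(e_r,e_\theta,e_z)$. Let $\chi,\varphi\ge 0$ be smooth compactly supported radial functions on $\mathbb R^3$, $\varphi$ supported away from $0$, with $\chi(\xi)+\sum_{q\ge0}\varphi(2^{-q}\xi)=1$ for all $\xi$, $\sum_{q\in\mathbb Z}\varphi(2^{-q}\xi)=1$ for $\xi\ne0$, $\operatorname{supp}\varphi(2^{-j}\cdot)\cap\operatorname{supp}\varphi(2^{-q}\cdot)=\varnothing$ for $|j-q|\ge2$ and $\operatorname{supp}\chi\cap\operatorname{supp}\varphi(2^{-q}\cdot)=\varnothing$ for $q\ge1$. Set $\Delta_q u=2^{3q}(\mathcal F^{-1}\varphi)(2^q\cdot)*u$ for $q\ge0$, $\Delta_{-1}u=(\mathcal F^{-1}\chi)*u$, $\Delta_q u=0$ for $q\le-2$, and $$\|u\|_{B^s_{p,r}}=\Big\|\big(2^{qs}\|\Delta_q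 u\|_{L^p}\big)_{q}\Big\|_{\ell^r(\mathbb Z)},\qquad \|u\|_{\widetilde L^1_tH^s}=\Big\|\big(2^{qs}\|\Delta_q u\|_{L^1((0,t);L^2)}\big)_{q}\Big\|_{\ell^2(\mathbb Z)}.$$ (i) For every $s>0$ there is a constant $C$, depending only on $s$ (and on $\chi,\varphi$), such that for every $t>0$ and every time-dependent field $b$ which is of the above form at each time in $(0,t)$ and satisfies $b^\theta/r\in L^\infty((0,t);L^\infty)$, $$\Big\|\frac{b^\theta}{r}\,b\Big\|_{\widetilde L^1_tH^s}\le C\,\Big\|\frac{b^\theta}{r}\Big\|_{L^\infty_tL^\infty}\,\|b\|_{\widetilde L^1_tH^s}.$$ (ii) For every $p\in[1,\infty]$ there is a constant $C$, depending only on $p$ (and on $\chi,\varphi$), such that for every $b$ of the above form with $b^\theta/r\in L^\infty$, $$\Big\|\frac{b^\theta}{r}\,b\Big\|_{B^{3/p+1}_{p,1}}\le C\,\Big\|\frac{b^\theta}{r}\Big\|_{L^\infty}\,\|b\|_{B^{3/p+1}_{p,1}}.$$ The norms of $b$ may be infinite, in which case the inequalities are trivial. -/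

import Mathlib

open MeasureTheory
open scoped ENNReal NNReal ContDiff FourierTransform Convolution

noncomputable section

namespace AxisymmetricProduct

/-- Physical space `ℝ³` with the Euclidean norm. -/
abbrev E3 : Type := EuclideanSpace ℝ (Fin 3)

/-! ### Littlewood-Paley decomposition -/

/-- A dyadic partition of unity `(χ, φ)` on `ℝ³`. -/
structure DyadicPartition where
  χ : E3 → ℝ
  φ : E3 → ℝ
  χ_smooth : ContDiff ℝ ∞ χ
  φ_smooth : ContDiff ℝ ∞ φ
  χ_compact : HasCompactSupport χ
  φ_compact : HasCompactSupport φ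
  φ_away : (0 : E3) ∉ tsupport φ
  χ_nonneg : ∀ ξ, 0 ≤ χ ξ
  φ_nonneg : ∀ ξ, 0 ≤ φ ξ
  χ_radial : ∀ ξ η : E3, ‖ξ‖ = ‖η‖ → χ ξ = χ η
  φ_radial : ∀ ξ η : E3, ‖ξ‖ = ‖η‖ → φ ξ = φ η
  sum_inhom : ∀ ξ : E3, HasSum (fun q : ℕ => φ ((2 : ℝ) ^ (-(q : ℤ)) • ξ)) (1 - χ ξ)
  sum_hom : ∀ ξ : E3, ξ ≠ 0 → HasSum (fun q : ℤ => φ ((2 : ℝ) ^ (-q) • ξ)) 1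
  φ_disjoint : ∀ j q : ℤ, 2 ≤ |j - q| →
    Disjoint (tsupport fun ξ : E3 => φ ((2 : ℝ) ^ (-j) • ξ))
      (tsupport fun ξ : E3 => φ ((2 : ℝ) ^ (-q) • ξ))
  χ_disjoint : ∀ q : ℤ, 1 ≤ q →
    Disjoint (tsupport χ) (tsupport fun ξ : E3 => φ ((2 : ℝ) ^ (-q) • ξ))

/-- The radial profile of the standard cut-off: `1` for `‖ξ‖ ≤ 3/4` and `0` for `‖ξ‖ ≥ 4/3`. -/
def cutoff (ξ : E3) : ℝ := Real.smoothTransition ((16 / 9 - ‖ξ‖ ^ 2) / (175 / 144))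

theorem cutoff_one {ξ : E3} (h : ‖ξ‖ ≤ 3 / 4) : cutoff ξ = 1 := by
  apply Real.smoothTransition.one_of_one_le
  have := norm_nonneg ξ
  rw [le_div_iff₀ (by norm_num)]
  nlinarith

theorem cutoff_zero {ξ : E3} (h : 4 / 3 ≤ ‖ξ‖) : cutoff ξ = 0 := by
  apply Real.smoothTransition.zero_of_nonpos
  apply div_nonpos_of_nonpos_of_nonneg _ (by norm_num)
  nlinarith

theorem cutoff_smooth : ContDiff ℝ ∞ cutoff :=
  Real.smoothTransition.contDiff.comp
    ((contDiff_const.sub (contDiff_id.norm_sq ℝ)).div_const _)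

/-- The annular cut-off attached to `cutoff`. -/
def annulus (ξ : E3) : ℝ := cutoff ((2 : ℝ)⁻¹ • ξ) - cutoff ξ

theorem annulus_nonneg (ξ : E3) : 0 ≤ annulus ξ := by
  apply sub_nonneg.2
  apply Real.smoothTransition.monotone
  have h : ‖(2 : ℝ)⁻¹ • ξ‖ ^ 2 ≤ ‖ξ‖ ^ 2 := by
    rw [norm_smul, mul_pow]
    norm_num
    nlinarith [sq_nonneg ‖ξ‖]
  gcongr

theorem tsupport_cutoff : tsupport cutoff ⊆ {ξ | ‖ξ‖ ≤ 4 / 3} := by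
  apply closure_minimal _ (isClosed_le continuous_norm continuous_const)
  intro ξ hξ
  by_contra h
  exact hξ (cutoff_zero (le_of_lt (not_le.1 h)))

theorem tsupport_annulus (j : ℤ) :
    tsupport (fun ξ : E3 => annulus ((2 : ℝ) ^ (-j) • ξ)) ⊆
      {ξ | 3 / 4 * (2 : ℝ) ^ j ≤ ‖ξ‖ ∧ ‖ξ‖ ≤ 8 / 3 * (2 : ℝ) ^ j} := by
  apply closure_minimal _ ((isClosed_le continuous_const continuous_norm).inter
    (isClosed_le continuous_norm continuous_const))
  intro ξ hξ
  have hp : (0 : ℝ) < 2 ^ j := by positivity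
  have hn : ‖(2 : ℝ) ^ (-j) • ξ‖ = ‖ξ‖ / 2 ^ j := by
    rw [norm_smul, zpow_neg, norm_inv, Real.norm_of_nonneg hp.le]
    field_simp
  have hn2 : ‖(2 : ℝ)⁻¹ • (2 : ℝ) ^ (-j) • ξ‖ = ‖ξ‖ / 2 ^ j / 2 := by
    rw [norm_smul, hn]
    norm_num
    ring
  constructor
  · by_contra h
    have h1 : ‖ξ‖ / 2 ^ j < 3 / 4 := (div_lt_iff₀ hp).2 (not_le.1 h)
    have h0 : 0 ≤ ‖ξ‖ / 2 ^ j := by positivity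
    apply hξ
    simp only [annulus]
    rw [cutoff_one (hn.le.trans h1.le), cutoff_one (hn2.le.trans (by linarith)), sub_self]
  · by_contra h
    have h1 : 8 / 3 < ‖ξ‖ / 2 ^ j := (lt_div_iff₀ hp).2 (not_le.1 h)
    apply hξ
    simp only [annulus]
    rw [cutoff_zero (le_trans (by linarith) hn.ge), cutoff_zero (le_trans (by linarith) hn2.ge),
      sub_self]

theorem annulus_disjoint {i q : ℤ} (h : i + 2 ≤ q) :
    Disjoint (tsupport fun ξ : E3 => annulus ((2 : ℝ) ^ (-i) • ξ))
      (tsupport fun ξ : E3 => annulus ((2 : ℝ) ^ (-q) • ξ)) := by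
  rw [Set.disjoint_left]
  intro ξ h1 h2
  have h1 := (tsupport_annulus i h1).2
  have h2 := (tsupport_annulus q h2).1
  have h3 : (2 : ℝ) ^ (i + 2) ≤ 2 ^ q := zpow_le_zpow_right₀ (by norm_num) h
  rw [zpow_add₀ (by norm_num)] at h3
  have hp : (0 : ℝ) < 2 ^ i := by positivity
  norm_num at h3
  linarith

theorem annulus_hasSum_nonneg (ξ : E3) :
    HasSum (fun q : ℕ => annulus ((2 : ℝ) ^ (-(q : ℤ)) • ξ)) (1 - cutoff ξ) := by
  rw [hasSum_iff_tendsto_nat_of_nonneg (fun _ => annulus_nonneg _)]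
  have hs : ∀ n : ℕ, ∑ q ∈ Finset.range n, annulus ((2 : ℝ) ^ (-(q : ℤ)) • ξ) =
      cutoff ((2 : ℝ) ^ (-(n : ℤ)) • ξ) - cutoff ξ := by
    intro n
    induction n with
    | zero => simp
    | succ n ih =>
      rw [Finset.sum_range_succ, ih, annulus, smul_smul]
      have : (2 : ℝ)⁻¹ * 2 ^ (-(n : ℤ)) = 2 ^ (-((n + 1 : ℕ) : ℤ)) := by
        rw [← zpow_neg_one, ← zpow_add₀ (by norm_num)]
        congr 1
        push_cast
        ring
      rw [this]
      ring
  simp_rw [hs]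
  have hl : Filter.Tendsto (fun n : ℕ => (2 : ℝ) ^ (-(n : ℤ)) • ξ) Filter.atTop (nhds 0) := by
    have h0 : Filter.Tendsto (fun n : ℕ => (2 : ℝ)⁻¹ ^ n) Filter.atTop (nhds 0) :=
      tendsto_pow_atTop_nhds_zero_of_lt_one (by norm_num) (by norm_num)
    simpa using h0.smul_const ξ
  have h1 := (cutoff_smooth.continuous.tendsto 0).comp hl
  rw [cutoff_one (ξ := 0) (by norm_num)] at h1
  exact h1.sub_const _

theorem annulus_hasSum_neg {ξ : E3} (hξ : ξ ≠ 0) :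
    HasSum (fun n : ℕ => annulus ((2 : ℝ) ^ (n + 1) • ξ)) (cutoff ξ) := by
  rw [hasSum_iff_tendsto_nat_of_nonneg (fun _ => annulus_nonneg _)]
  have hs : ∀ n : ℕ, ∑ q ∈ Finset.range n, annulus ((2 : ℝ) ^ (q + 1) • ξ) =
      cutoff ξ - cutoff ((2 : ℝ) ^ n • ξ) := by
    intro n
    induction n with
    | zero => simp
    | succ n ih =>
      rw [Finset.sum_range_succ, ih, annulus, smul_smul]
      have : (2 : ℝ)⁻¹ * 2 ^ (n + 1) = 2 ^ n := by
        rw [pow_succ]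
        ring
      rw [this]
      ring
  simp_rw [hs]
  apply tendsto_const_nhds.congr'
  have hp : 0 < ‖ξ‖ := norm_pos_iff.2 hξ
  have hl : Filter.Tendsto (fun n : ℕ => (2 : ℝ) ^ n * ‖ξ‖) Filter.atTop Filter.atTop :=
    (tendsto_pow_atTop_atTop_of_one_lt (by norm_num)).atTop_mul_const hp
  filter_upwards [hl.eventually_ge_atTop (4 / 3)] with n hn
  rw [cutoff_zero (ξ := (2 : ℝ) ^ n • ξ) (by rw [norm_smul]; simpa using hn), sub_zero]

/-- Dyadic partitions of unity exist. -/
theorem DyadicPartition.nonempty : Nonempty DyadicPartition := by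
  have h0 : tsupport annulus ⊆ {ξ | 3 / 4 ≤ ‖ξ‖ ∧ ‖ξ‖ ≤ 8 / 3} := by
    simpa using tsupport_annulus 0
  refine ⟨{
    χ := cutoff
    φ := annulus
    χ_smooth := cutoff_smooth
    φ_smooth := (cutoff_smooth.comp (contDiff_const_smul _)).sub cutoff_smooth
    χ_compact := ?_
    φ_compact := ?_
    φ_away := ?_
    χ_nonneg := fun _ => Real.smoothTransition.nonneg _
    φ_nonneg := annulus_nonneg
    χ_radial := ?_
    φ_radial := ?_
    sum_inhom := annulus_hasSum_nonneg
    sum_hom := ?_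
    φ_disjoint := ?_
    χ_disjoint := ?_ }⟩
  · refine (isCompact_closedBall (0 : E3) (4 / 3)).of_isClosed_subset (isClosed_tsupport _) ?_
    intro ξ h
    simpa using tsupport_cutoff h
  · refine (isCompact_closedBall (0 : E3) (8 / 3)).of_isClosed_subset (isClosed_tsupport _) ?_
    intro ξ h
    simpa using (h0 h).2
  · intro h
    have := (h0 h).1
    norm_num at this
  · intro ξ η h
    simp only [cutoff, h]
  · intro ξ η h
    simp only [annulus, cutoff, norm_smul, h]
  · intro ξ hξ
    have h1 : HasSum (fun n : ℕ => annulus ((2 : ℝ) ^ (-(-((n : ℤ) + 1))) • ξ)) (cutoff ξ) := by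
      convert annulus_hasSum_neg hξ using 4 with n
      rw [neg_neg, ← zpow_natCast]
      push_cast
      rfl
    have h2 := HasSum.of_nat_of_neg_add_one
      (f := fun q : ℤ => annulus ((2 : ℝ) ^ (-q) • ξ)) (annulus_hasSum_nonneg ξ) h1
    simpa using h2
  · intro j q h
    rcases le_abs.1 h with h | h
    · exact (annulus_disjoint (by linarith)).symm
    · exact annulus_disjoint (by linarith)
  · intro q hq
    rw [Set.disjoint_left]
    intro ξ h1 h2
    have h1 : ‖ξ‖ ≤ 4 / 3 := tsupport_cutoff h1
    have h2 := (tsupport_annulus q h2).1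
    have h3 : (2 : ℝ) ^ (1 : ℤ) ≤ 2 ^ q := zpow_le_zpow_right₀ (by norm_num) hq
    norm_num at h3
    linarith

/-- The inverse Fourier transform of a real radial symbol `m`, as a real function: it is
real-valued because `m` is real and even. -/
def kernel (m : E3 → ℝ) (x : E3) : ℝ :=
  (𝓕⁻ (fun ξ : E3 => (m ξ : ℂ)) x).re

/-- The nonhomogeneous dyadic block `Δ_q u` of a vector field: `Δ_q u = 2^{3q} h(2^q ·) ∗ u`
for `q ≥ 0` with `h = 𝓕⁻ φ`, `Δ_{-1} u = g ∗ u` with `g = 𝓕⁻ χ`, and `Δ_q u = 0` for `q ≤ -2`. -/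
def block (P : DyadicPartition) (q : ℤ) (u : E3 → E3) : E3 → E3 :=
  if 0 ≤ q then
    (fun x => (2 : ℝ) ^ (3 * q) * kernel P.φ ((2 : ℝ) ^ q • x)) ⋆[ContinuousLinearMap.lsmul ℝ ℝ] u
  else if q = -1 then
    kernel P.χ ⋆[ContinuousLinearMap.lsmul ℝ ℝ] u
  else 0

/-- The Besov norm `‖u‖_{B^s_{p,r}} = ‖(2^{qs} ‖Δ_q u‖_{L^p})_q‖_{ℓ^r(ℤ)}`. -/
def besovNorm (P : DyadicPartition) (s : ℝ) (p r : ℝ≥0∞) (u : E3 → E3) : ℝ≥0∞ :=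
  eLpNorm (fun q : ℤ => (2 : ℝ≥0∞) ^ ((q : ℝ) * s) * eLpNorm (block P q u) p volume) r
    Measure.count

/-- The mixed norm `‖u‖_{L^ρ_t L^p}` over the time interval `(0, t)`. -/
def timeSpaceNorm {F : Type*} [NormedAddCommGroup F] (t : ℝ) (ρ p : ℝ≥0∞) (u : ℝ → E3 → F) :
    ℝ≥0∞ :=
  eLpNorm (fun τ : ℝ => eLpNorm (u τ) p volume) ρ (volume.restrict (Set.Ioo 0 t))

/-- The Chemin-Lerner norm
`‖u‖_{L̃^ρ_t B^s_{p,r}} = ‖(2^{qs} ‖Δ_q u‖_{L^ρ_t L^p})_q‖_{ℓ^r(ℤ)}`. -/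
def cheminLernerNorm (P : DyadicPartition) (t : ℝ) (ρ : ℝ≥0∞) (s : ℝ) (p r : ℝ≥0∞)
    (u : ℝ → E3 → E3) : ℝ≥0∞ :=
  eLpNorm
    (fun q : ℤ => (2 : ℝ≥0∞) ^ ((q : ℝ) * s) * timeSpaceNorm t ρ p (fun τ => block P q (u τ))) r
    Measure.count

/-! ### Axisymmetric vector fields -/

/-- The rotation of angle `α` around the vertical axis. -/
def rot (α : ℝ) (x : E3) : E3 :=
  !₂[Real.cos α * x 0 - Real.sin α * x 1, Real.sin α * x 0 + Real.cos α * x 1, x 2]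

/-- `R_{-α} (b (R_α x)) = b x` for every angle `α` and every point `x`. -/
def IsAxisymmetric (b : E3 → E3) : Prop :=
  ∀ α ∈ Set.Icc (0 : ℝ) (2 * Real.pi), ∀ x : E3, rot (-α) (b (rot α x)) = b x

/-- The distance `r` to the vertical axis. -/
def axisDist (x : E3) : ℝ := Real.sqrt (x 0 ^ 2 + x 1 ^ 2)

/-- The cylindrical basis vector `e_r = (cos θ, sin θ, 0)`. -/
def eR (x : E3) : E3 := !₂[x 0 / axisDist x, x 1 / axisDist x, 0]

/-- The cylindrical basis vector `e_θ = (-sin θ, cos θ, 0)`. -/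
def eTheta (x : E3) : E3 := !₂[-(x 1 / axisDist x), x 0 / axisDist x, 0]

/-- The radial component `b^r`. -/
def radialPart (b : E3 → E3) (x : E3) : ℝ := inner ℝ (b x) (eR x)

/-- The angular component `b^θ`. -/
def angularPart (b : E3 → E3) (x : E3) : ℝ := inner ℝ (b x) (eTheta x)

/-- The vertical component `b^z`. -/
def verticalPart (b : E3 → E3) (x : E3) : ℝ := b x 2

/-- Smooth axisymmetric vector fields of the form `b = b^θ(r, z) e_θ`. The components are tested
off the vertical axis, where the cylindrical basis is defined. -/
structure IsSmoothSwirl (b : E3 → E3) : Prop where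
  smooth : ContDiff ℝ ∞ b
  axisymmetric : IsAxisymmetric b
  radial_eq_zero : ∀ x, axisDist x ≠ 0 → radialPart b x = 0
  vertical_eq_zero : ∀ x, axisDist x ≠ 0 → verticalPart b x = 0

/-- The scalar function `b^θ / r`, defined off the vertical axis (a null set). -/
def swirlRatio (b : E3 → E3) (x : E3) : ℝ := angularPart b x / axisDist x

/-- The vector field `(b^θ / r) b`. -/
def swirlProduct (b : E3 → E3) (x : E3) : E3 := swirlRatio b x • b x

end AxisymmetricProduct

end

/-!
A component `u` of `b` is odd across a plane `⟪e, x⟫ = 0` and satisfies `|u| ≤ M |⟪e, x⟫|` with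
`M = ‖b^θ / r‖_∞`, and the corresponding component of `(b^θ / r) b` is `u ^ 2 / ⟪e, ·⟫`. Let `u_n`
be the low frequency cut-offs of `u` and telescope
`u ^ 2 / ⟪e, ·⟫ = ∑ (u_{n+1} ^ 2 - u_n ^ 2) / ⟪e, ·⟫`. The cut-off kernels are radial, so `u_n` is
still odd, hence `|u_n| ≤ C M |⟪e, x⟫|`, and the `n`-th difference is at most
`2 C M |u_{n+1} - u_n|`, a dyadic block of `u`. Moreover `u_n / ⟪e, ·⟫` is an average of `∂_e u_n`
composed with the maps that shrink the `e`-component by a factor `t ∈ [0, 1]`; these shrink the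
spectrum too, so `u_n ^ 2 / ⟪e, ·⟫` keeps its frequencies below a multiple of `2 ^ n`. The `m`-th
block of the product is thus controlled by `C M ∑_{n ≥ m - N} ‖Δ_n b‖`, and since `s > 0` the
weights `2 ^ (m s)` turn this into a convolution with a convergent geometric series.
-/

noncomputable section

namespace AxisymmetricProduct

open ContinuousLinearMap (lsmul)
open Filter Topology InnerProductSpace

section LpNorms

variable {α β E : Type*} [MeasurableSpace α] [MeasurableSpace β] {μ : Measure α}
  [NormedAddCommGroup E] {p : ℝ≥0∞}

theorem eLpNorm_tsum_le {f : ℕ → α → ℝ≥0∞} (hf : ∀ k, AEMeasurable (f k) μ) (hp : 1 ≤ p) :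
    eLpNorm (fun x => ∑' k, f k x) p μ ≤ ∑' k, eLpNorm (f k) p μ := by
  rcases eq_or_ne p ⊤ with rfl | hp'
  · refine eLpNormEssSup_le_of_ae_enorm_bound ?_
    filter_upwards [ae_all_iff.2 fun k => enorm_ae_le_eLpNormEssSup (f k) μ] with x hx
    exact ENNReal.tsum_le_tsum hx
  have hp0 : p ≠ 0 := (zero_lt_one.trans_le hp).ne'
  have hpos : 0 < p.toReal := ENNReal.toReal_pos hp0 hp'
  have hpartial : ∀ n : ℕ, ∫⁻ x, (∑ k ∈ Finset.range n, f k x) ^ p.toReal ∂μ ≤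
      (∑' k, eLpNorm (f k) p μ) ^ p.toReal := by
    intro n
    have h := (eLpNorm_sum_le (s := Finset.range n) (fun k _ => (hf k).aestronglyMeasurable)
      hp).trans (ENNReal.sum_le_tsum _)
    rw [eLpNorm_eq_lintegral_rpow_enorm_toReal hp0 hp', one_div,
      ENNReal.rpow_inv_le_iff hpos] at h
    simpa using h
  rw [eLpNorm_eq_lintegral_rpow_enorm_toReal hp0 hp', one_div, ENNReal.rpow_inv_le_iff hpos]
  simp only [enorm_eq_self]
  refine le_of_tendsto' (lintegral_tendsto_of_tendsto_of_monotone
    (f := fun n x => (∑ k ∈ Finset.range n, f k x) ^ p.toReal)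
    (fun n => (Finset.aemeasurable_fun_sum _ fun k _ => hf k).pow_const _)
    (.of_forall fun x _ _ hn => ?_) (.of_forall fun x => ?_)) hpartial
  · exact ENNReal.rpow_le_rpow (Finset.sum_le_sum_of_subset (Finset.range_mono hn)) hpos.le
  · exact (ENNReal.continuous_rpow_const.tendsto _).comp (ENNReal.tendsto_nat_tsum _)

theorem eLpNorm_le_tsum_eLpNorm_sub {f : ℕ → α → E} {g : α → E}
    (hf : ∀ n, AEStronglyMeasurable (f n) μ) (hp : 1 ≤ p) (h0 : f 0 = 0)
    (hlim : ∀ᵐ x ∂μ, Tendsto (fun n => f n x) atTop (𝓝 (g x))) :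
    eLpNorm g p μ ≤ ∑' n, eLpNorm (f (n + 1) - f n) p μ := by
  have hpartial (J : ℕ) : eLpNorm (f J) p μ ≤ ∑' n, eLpNorm (f (n + 1) - f n) p μ := by
    rw [← sub_zero (f J), ← h0, ← Finset.sum_range_sub]
    exact (eLpNorm_sum_le (fun n _ => (hf (n + 1)).sub (hf n)) hp).trans (ENNReal.sum_le_tsum _)
  exact (Lp.eLpNorm_lim_le_liminf_eLpNorm hf g hlim).trans
    (liminf_le_of_le (by isBoundedDefault) fun b hb => hb.exists.elim fun J hJ =>
      hJ.trans (hpartial J))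

theorem measurable_eLpNorm_prodMk {ν : Measure β} [SFinite ν] {F : α × β → E}
    (hF : StronglyMeasurable F) (p : ℝ≥0∞) :
    Measurable fun a => eLpNorm (fun b => F (a, b)) p ν := by
  rcases eq_or_ne p 0 with rfl | hp0
  · simp only [eLpNorm_exponent_zero, measurable_const]
  rcases eq_or_ne p ⊤ with rfl | hp
  · refine measurable_of_Iic fun c => ?_
    have hs : MeasurableSet {z | c < ‖F z‖ₑ} := measurableSet_lt measurable_const hF.enorm
    convert measurable_measure_prodMk_left (ν := ν) hs (measurableSet_singleton 0) using 1
    ext a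
    have hle : eLpNorm (fun b => F (a, b)) ⊤ ν ≤ c ↔ ∀ᵐ b ∂ν, ‖F (a, b)‖ₑ ≤ c :=
      ⟨fun h => (enorm_ae_le_eLpNormEssSup _ ν).mono fun b hb => hb.trans h,
        eLpNormEssSup_le_of_ae_enorm_bound⟩
    simp only [Set.mem_preimage, Set.mem_Iic, Set.mem_singleton_iff, hle, ae_iff, not_le]
    rfl
  · simp only [eLpNorm_eq_lintegral_rpow_enorm_toReal hp0 hp]
    exact (hF.enorm.pow_const _).lintegral_prod_right'.pow_const _

theorem aemeasurable_eLpNorm_prodMk {ν : Measure β} [SFinite ν] {F : α × β → E}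
    (hF : AEStronglyMeasurable F (μ.prod ν)) (p : ℝ≥0∞) :
    AEMeasurable (fun a => eLpNorm (fun b => F (a, b)) p ν) μ :=
  ⟨_, measurable_eLpNorm_prodMk hF.stronglyMeasurable_mk p,
    (Measure.ae_ae_of_ae_prod hF.ae_eq_mk).mono fun _ ha => eLpNorm_congr_ae ha⟩

theorem lintegral_mul_rpow_le {w f : α → ℝ≥0∞} (hw : AEMeasurable w μ) (hf : AEMeasurable f μ)
    {p : ℝ} (hp : 1 ≤ p) :
    (∫⁻ x, w x * f x ∂μ) ^ p ≤ (∫⁻ x, w x ∂μ) ^ (p - 1) * ∫⁻ x, w x * f x ^ p ∂μ := by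
  have hp0 : 0 < p := by linarith
  have hq : 0 ≤ 1 - p⁻¹ := sub_nonneg.2 (inv_le_one_of_one_le₀ hp)
  have hsplit : ∀ x, w x * f x = w x ^ (1 - p⁻¹) * (w x * f x ^ p) ^ p⁻¹ := fun x => by
    rw [ENNReal.mul_rpow_of_nonneg _ _ (by positivity), ← ENNReal.rpow_mul,
      mul_inv_cancel₀ hp0.ne', ENNReal.rpow_one, ← mul_assoc,
      ← ENNReal.rpow_add_of_nonneg _ _ hq (by positivity), sub_add_cancel, ENNReal.rpow_one]
  have holder := ENNReal.lintegral_mul_norm_pow_le hw (hw.mul (hf.pow_const p)) hq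
    (by positivity) (sub_add_cancel 1 p⁻¹)
  simp only [Pi.mul_apply, ← hsplit] at holder
  refine (ENNReal.rpow_le_rpow holder hp0.le).trans_eq ?_
  rw [ENNReal.mul_rpow_of_nonneg _ _ hp0.le, ← ENNReal.rpow_mul, ← ENNReal.rpow_mul,
    inv_mul_cancel₀ hp0.ne', ENNReal.rpow_one, sub_mul, one_mul, inv_mul_cancel₀ hp0.ne']

end LpNorms

section Convolution

variable {G E E' F : Type*} [AddGroup G] [MeasurableSpace G] [MeasurableAdd₂ G] [MeasurableNeg G]
  {μ : Measure G} [SFinite μ] [μ.IsAddRightInvariant] [NormedAddCommGroup E] [NormedSpace ℝ E]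
  [NormedAddCommGroup E'] [NormedSpace ℝ E'] [NormedAddCommGroup F] [NormedSpace ℝ F]

theorem eLpNorm_lintegral_mul_sub_le {f g : G → ℝ≥0∞} (hf : AEMeasurable f μ)
    (hg : AEMeasurable g μ) {p : ℝ≥0∞} (hp : 1 ≤ p) :
    eLpNorm (fun x => ∫⁻ t, f t * g (x - t) ∂μ) p μ ≤ (∫⁻ t, f t ∂μ) * eLpNorm g p μ := by
  have hgx : ∀ x, AEMeasurable (fun t => g (x - t)) μ := fun x =>
    hg.comp_quasiMeasurePreserving (quasiMeasurePreserving_sub_left_of_right_invariant μ x)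
  rcases eq_or_ne p ⊤ with rfl | hp'
  · refine eLpNormEssSup_le_of_ae_enorm_bound (.of_forall fun x => ?_)
    rw [enorm_eq_self, ← lintegral_mul_const'' _ hf]
    refine lintegral_mono_ae ?_
    filter_upwards [(quasiMeasurePreserving_sub_left_of_right_invariant μ x).ae
      (enorm_ae_le_eLpNormEssSup g μ)] with t ht
    exact mul_le_mul_right ht _
  have hp0 : p ≠ 0 := (zero_lt_one.trans_le hp).ne'
  have hp1 : 1 ≤ p.toReal := by simpa using ENNReal.toReal_mono hp' hp
  have hpos : 0 < p.toReal := by linarith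
  have hprod : AEMeasurable (fun z : G × G => f z.2 * g (z.1 - z.2) ^ p.toReal) (μ.prod μ) :=
    hf.comp_snd.mul ((hg.comp_quasiMeasurePreserving
      (quasiMeasurePreserving_sub_of_right_invariant μ μ)).pow_const _)
  have hswap : ∫⁻ x, ∫⁻ t, f t * g (x - t) ^ p.toReal ∂μ ∂μ =
      (∫⁻ t, f t ∂μ) * ∫⁻ y, g y ^ p.toReal ∂μ := by
    rw [lintegral_lintegral_swap hprod, ← lintegral_mul_const'' _ hf]
    refine lintegral_congr fun t => ?_
    have hgt : AEMeasurable (fun x => g (x - t)) μ := hg.comp_quasiMeasurePreserving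
      (measurePreserving_sub_right μ t).quasiMeasurePreserving
    rw [lintegral_const_mul'' _ (hgt.pow_const _),
      lintegral_sub_right_eq_self (fun y => g y ^ p.toReal) t]
  rw [eLpNorm_eq_lintegral_rpow_enorm_toReal hp0 hp', one_div, ENNReal.rpow_inv_le_iff hpos,
    ENNReal.mul_rpow_of_nonneg _ _ hpos.le, eLpNorm_eq_lintegral_rpow_enorm_toReal hp0 hp',
    ← ENNReal.rpow_mul, one_div_mul_cancel hpos.ne', ENNReal.rpow_one]
  simp only [enorm_eq_self]
  calc ∫⁻ x, (∫⁻ t, f t * g (x - t) ∂μ) ^ p.toReal ∂μ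
      ≤ ∫⁻ x, (∫⁻ t, f t ∂μ) ^ (p.toReal - 1) * ∫⁻ t, f t * g (x - t) ^ p.toReal ∂μ ∂μ :=
        lintegral_mono fun x => lintegral_mul_rpow_le hf (hgx x) hp1
    _ = (∫⁻ t, f t ∂μ) ^ (p.toReal - 1) * (∫⁻ t, f t ∂μ) ^ (1 : ℝ) *
          ∫⁻ y, g y ^ p.toReal ∂μ := by
        rw [lintegral_const_mul'' _ hprod.lintegral_prod_right', hswap, ENNReal.rpow_one,
          mul_assoc]
    _ = (∫⁻ t, f t ∂μ) ^ p.toReal * ∫⁻ y, g y ^ p.toReal ∂μ := by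
        rw [← ENNReal.rpow_add_of_nonneg _ _ (by linarith) zero_le_one, sub_add_cancel]

theorem eLpNorm_convolution_le (L : E →L[ℝ] E' →L[ℝ] F) {f : G → E} {g : G → E'}
    (hf : AEStronglyMeasurable f μ) (hg : AEStronglyMeasurable g μ) {p : ℝ≥0∞} (hp : 1 ≤ p) :
    eLpNorm (f ⋆[L, μ] g) p μ ≤ ‖L‖ₑ * (eLpNorm f 1 μ * eLpNorm g p μ) := by
  calc eLpNorm (f ⋆[L, μ] g) p μ
      ≤ ‖L‖ₑ * eLpNorm (fun x => ∫⁻ t, ‖f t‖ₑ * ‖g (x - t)‖ₑ ∂μ) p μ := by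
        refine eLpNorm_le_mul_eLpNorm_of_ae_le_mul' (c := ‖L‖₊) (.of_forall fun x => ?_) p
        rw [enorm_eq_self, ← enorm_eq_nnnorm, ← lintegral_const_mul' _ _ enorm_ne_top]
        refine (enorm_integral_le_lintegral_enorm _).trans (lintegral_mono fun t => ?_)
        rw [← mul_assoc]
        exact L.le_opENorm₂ (f t) (g (x - t))
    _ ≤ ‖L‖ₑ * (eLpNorm f 1 μ * eLpNorm g p μ) := by
        rw [eLpNorm_one_eq_lintegral_enorm, ← eLpNorm_enorm g]
        exact mul_le_mul_right (eLpNorm_lintegral_mul_sub_le hf.enorm hg.enorm hp) _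

theorem eLpNorm_lsmul_convolution_le {f : G → ℝ} {g : G → E}
    (hf : AEStronglyMeasurable f μ) (hg : AEStronglyMeasurable g μ) {p : ℝ≥0∞} (hp : 1 ≤ p) :
    eLpNorm (f ⋆[lsmul ℝ ℝ, μ] g) p μ ≤ eLpNorm f 1 μ * eLpNorm g p μ := by
  refine (eLpNorm_convolution_le _ hf hg hp).trans (mul_le_of_le_one_left' ?_)
  rw [← enorm_one (G := ℝ), enorm_le_iff_norm_le]
  simpa using ContinuousLinearMap.opNorm_lsmul_le

end Convolution

section WeightedSequences

theorem eLpNorm_count_comp_add_right (c : ℤ → ℝ≥0∞) (r : ℝ≥0∞) (j : ℤ) :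
    eLpNorm (fun q => c (q + j)) r Measure.count = eLpNorm c r Measure.count :=
  eLpNorm_comp_measurePreserving (measurable_of_countable c).aestronglyMeasurable
    (measurePreserving_add_right Measure.count j)

theorem ennreal_two_rpow_add (x y : ℝ) : (2 : ℝ≥0∞) ^ (x + y) = 2 ^ x * 2 ^ y :=
  ENNReal.rpow_add x y two_ne_zero ENNReal.ofNat_ne_top

theorem tsum_two_rpow_sub_mul_ne_top {s : ℝ} (hs : 0 < s) (N : ℕ) :
    ∑' k : ℕ, (2 : ℝ≥0∞) ^ (((N : ℝ) - k) * s) ≠ ⊤ := by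
  have hgeom : ∀ k : ℕ, (2 : ℝ≥0∞) ^ (((N : ℝ) - k) * s) = 2 ^ ((N : ℝ) * s) * (2 ^ (-s)) ^ k := by
    intro k
    rw [← ENNReal.rpow_natCast, ← ENNReal.rpow_mul, ← ennreal_two_rpow_add]
    congr 1
    ring
  simp only [hgeom, ENNReal.tsum_mul_left, ENNReal.tsum_geometric]
  refine ENNReal.mul_ne_top (ENNReal.rpow_ne_top_of_nonneg (by positivity)
    ENNReal.ofNat_ne_top) (ENNReal.inv_ne_top.2 ?_)
  rw [Ne, tsub_eq_zero_iff_le, not_le]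
  exact ENNReal.rpow_lt_one_of_one_lt_of_neg ENNReal.one_lt_two (neg_lt_zero.2 hs)

theorem exists_eLpNorm_two_rpow_mul_le {s : ℝ} (hs : 0 < s) (N : ℕ) :
    ∃ C : ℝ≥0, ∀ r : ℝ≥0∞, 1 ≤ r → ∀ (K : ℝ≥0∞) (a c : ℤ → ℝ≥0∞),
      (∀ q, a q ≤ K * ∑' k : ℕ, c (q + (k - N))) →
      eLpNorm (fun q : ℤ => (2 : ℝ≥0∞) ^ ((q : ℝ) * s) * a q) r Measure.count ≤
        C * K * eLpNorm (fun q : ℤ => (2 : ℝ≥0∞) ^ ((q : ℝ) * s) * c q) r Measure.count := by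
  set d : ℕ → ℝ≥0∞ := fun k => (2 : ℝ≥0∞) ^ (((N : ℝ) - k) * s) with hd
  refine ⟨(∑' k, d k).toNNReal, fun r hr K a c h => ?_⟩
  rw [ENNReal.coe_toNNReal (tsum_two_rpow_sub_mul_ne_top hs N)]
  set Y : ℤ → ℝ≥0∞ := fun q => (2 : ℝ≥0∞) ^ ((q : ℝ) * s) * c q with hY
  have hweight : ∀ (q : ℤ) (k : ℕ),
      (2 : ℝ≥0∞) ^ ((q : ℝ) * s) = d k * 2 ^ (((q + (k - N) : ℤ) : ℝ) * s) := by
    intro q k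
    rw [hd, ← ennreal_two_rpow_add]
    congr 1
    push_cast
    ring
  have hpoint : ∀ q : ℤ,
      (2 : ℝ≥0∞) ^ ((q : ℝ) * s) * a q ≤ ∑' k : ℕ, K * d k * Y (q + (k - N)) := by
    intro q
    refine (mul_le_mul_right (h q) _).trans_eq ?_
    rw [← ENNReal.tsum_mul_left, ← ENNReal.tsum_mul_left]
    refine tsum_congr fun k => ?_
    rw [hweight q k, hY]
    ring
  calc _ ≤ eLpNorm (fun q : ℤ => ∑' k : ℕ, K * d k * Y (q + (k - N))) r Measure.count :=
        eLpNorm_mono_enorm fun q => by simpa only [enorm_eq_self] using hpoint q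
    _ ≤ ∑' k : ℕ, eLpNorm (fun q : ℤ => K * d k * Y (q + (k - N))) r Measure.count :=
        eLpNorm_tsum_le (fun k => (measurable_of_countable _).aemeasurable) hr
    _ ≤ ∑' k : ℕ, K * d k * eLpNorm Y r Measure.count := by
        refine ENNReal.tsum_le_tsum fun k => ?_
        rw [← eLpNorm_count_comp_add_right Y r (k - N)]
        exact eLpNorm_le_mul_eLpNorm_of_ae_le_mul'' r
          (measurable_of_countable _).aestronglyMeasurable (.of_forall fun _ => le_rfl)
    _ = (∑' k, d k) * K * eLpNorm Y r Measure.count := by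
        rw [ENNReal.tsum_mul_right, ENNReal.tsum_mul_left, mul_comm K]

theorem tsum_ite_le_tsum_add_sub (c : ℤ → ℝ≥0∞) (m N : ℕ) :
    ∑' n : ℕ, (if m ≤ n + N then c ((n : ℤ) - 1) else 0) ≤
      ∑' k : ℕ, c ((m : ℤ) - 1 + (k - N)) := by
  have hind : (fun n : ℕ => if m ≤ n + N then c ((n : ℤ) - 1) else 0) =
      Set.indicator {n : ℕ | m ≤ n + N}
        fun n => c ((m : ℤ) - 1 + (((n + N - m : ℕ) : ℤ) - N)) := by
    ext n
    rw [Set.indicator_apply]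
    refine if_ctx_congr Iff.rfl (fun hn => congrArg c ?_) fun _ => rfl
    have hn : m ≤ n + N := hn
    omega
  rw [hind, ← tsum_subtype]
  refine ENNReal.tsum_comp_le_tsum_of_injective (f := fun n : {n : ℕ | m ≤ n + N} =>
    (n : ℕ) + N - m) (fun n n' hnn => Subtype.ext ?_) fun k => c ((m : ℤ) - 1 + ((k : ℤ) - N))
  have h := n.2
  have h' := n'.2
  simp only [Set.mem_ofPred_eq] at h h' hnn
  omega

end WeightedSequences

section RapidDecay

theorem one_add_norm_sub_le {V : Type*} [SeminormedAddCommGroup V] (x y : V) :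
    1 + ‖x - y‖ ≤ (1 + ‖x‖) * (1 + ‖y‖) := by
  nlinarith [norm_sub_le x y, mul_nonneg (norm_nonneg x) (norm_nonneg y)]

theorem norm_smul_comp_sub_le {V F : Type*} [SeminormedAddCommGroup V] [NormedAddCommGroup F]
    [NormedSpace ℝ F] {k : V → ℝ} {u : V → F} {M : ℝ} (hM0 : 0 ≤ M)
    (hM : ∀ y, ‖u y‖ ≤ M * (1 + ‖y‖)) (x z : V) :
    ‖k z • u (x - z)‖ ≤ M * (1 + ‖x‖) * ((1 + ‖z‖) * |k z|) := by
  rw [norm_smul, Real.norm_eq_abs]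
  calc |k z| * ‖u (x - z)‖ ≤ |k z| * (M * ((1 + ‖x‖) * (1 + ‖z‖))) := by
        gcongr
        exact (hM _).trans (by gcongr; exact one_add_norm_sub_le x z)
    _ = _ := by ring

variable {V F : Type*} [NormedAddCommGroup V] [InnerProductSpace ℝ V] [FiniteDimensional ℝ V]
  [MeasurableSpace V] [BorelSpace V] [NormedAddCommGroup F]

/-- Bounded continuous functions all of whose polynomial moments are absolutely convergent: a class
of convolution kernels that contains the real parts of Schwartz functions. -/
structure RapidDecay (k : V → ℝ) : Prop where
  continuous : Continuous k
  integrable_weight : ∀ n : ℕ, Integrable fun x => (1 + ‖x‖) ^ n * k x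
  bounded : ∃ B : ℝ, ∀ x, |k x| ≤ B

/-- Measurable functions of at most linear growth: the class of functions that are convolved with
rapidly decaying kernels. -/
structure LinearGrowth (u : V → F) : Prop where
  aestronglyMeasurable : AEStronglyMeasurable u volume
  bound : ∃ M : ℝ, 0 ≤ M ∧ ∀ y, ‖u y‖ ≤ M * (1 + ‖y‖)

variable {k : V → ℝ} {u v : V → F}

theorem LinearGrowth.sub (hu : LinearGrowth u) (hv : LinearGrowth v) : LinearGrowth (u - v) := by
  obtain ⟨M, hM0, hM⟩ := hu.bound
  obtain ⟨M', hM0', hM'⟩ := hv.bound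
  refine ⟨hu.1.sub hv.1, M + M', by positivity, fun y => ?_⟩
  rw [Pi.sub_apply]
  linarith [norm_sub_le (u y) (v y), hM y, hM' y]

theorem LinearGrowth.of_norm_le_inner (hu : AEStronglyMeasurable u volume) {M : ℝ} (hM : 0 ≤ M)
    {e : V} (he : ‖e‖ = 1) (h : ∀ y, ‖u y‖ ≤ M * |inner ℝ e y|) : LinearGrowth u := by
  refine ⟨hu, M, hM, fun y => (h y).trans ?_⟩
  have hey : |inner ℝ e y| ≤ ‖y‖ := by simpa [he] using abs_real_inner_le_norm e y
  gcongr
  linarith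

theorem RapidDecay.integrable (hk : RapidDecay k) : Integrable k := by
  simpa using hk.integrable_weight 0

theorem RapidDecay.integrable_one_add_norm_mul_abs (hk : RapidDecay k) :
    Integrable fun x => (1 + ‖x‖) * |k x| := by
  refine (hk.integrable_weight 1).norm.congr (.of_forall fun x => ?_)
  simp only [pow_one, norm_mul, Real.norm_eq_abs]
  rw [abs_of_nonneg (by positivity : 0 ≤ 1 + ‖x‖)]

theorem RapidDecay.integrable_pow_mul_comp_sub_left (hk : RapidDecay k) (n : ℕ) (x : V) :
    Integrable fun v => (1 + ‖v‖) ^ n * k (x - v) := by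
  have hc := hk.continuous
  refine (((hk.integrable_weight n).comp_sub_left x).norm.const_mul ((1 + ‖x‖) ^ n)).mono'
    (Continuous.aestronglyMeasurable (by fun_prop)) (.of_forall fun v => ?_)
  have hv : 1 + ‖v‖ ≤ (1 + ‖x‖) * (1 + ‖x - v‖) := by
    simpa using one_add_norm_sub_le x (x - v)
  rw [norm_mul, norm_mul, norm_pow, norm_pow, Real.norm_of_nonneg (by positivity : 0 ≤ 1 + ‖v‖),
    Real.norm_of_nonneg (by positivity : 0 ≤ 1 + ‖x - v‖), ← mul_assoc, ← mul_pow]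
  gcongr

variable [NormedSpace ℝ F]

theorem RapidDecay.convolutionExists (hk : RapidDecay k) (hu : LinearGrowth u) :
    ConvolutionExists k u (lsmul ℝ ℝ) := by
  intro x
  obtain ⟨M, hM0, hM⟩ := hu.bound
  exact (hk.integrable_one_add_norm_mul_abs.const_mul _).mono'
    (hk.continuous.aestronglyMeasurable.smul
      (hu.1.comp_quasiMeasurePreserving (quasiMeasurePreserving_sub_left volume x)))
    (.of_forall (norm_smul_comp_sub_le hM0 hM x))

theorem RapidDecay.integral_norm_smul_comp_sub_le (hk : RapidDecay k) {M : ℝ} (hM0 : 0 ≤ M)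
    (hM : ∀ y, ‖u y‖ ≤ M * (1 + ‖y‖)) (x : V) :
    ∫ z, ‖k z • u (x - z)‖ ≤ M * (1 + ‖x‖) * ∫ z, (1 + ‖z‖) * |k z| := by
  rw [← integral_const_mul]
  exact integral_mono_of_nonneg (.of_forall fun _ => norm_nonneg _)
    (hk.integrable_one_add_norm_mul_abs.const_mul _)
    (.of_forall (norm_smul_comp_sub_le hM0 hM x))

theorem aestronglyMeasurable_convolution (hk : AEStronglyMeasurable k volume)
    (hu : AEStronglyMeasurable u volume) : AEStronglyMeasurable (k ⋆ u) volume :=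
  (hk.convolution_integrand (lsmul ℝ ℝ) hu).integral_prod_right'

theorem RapidDecay.linearGrowth_convolution (hk : RapidDecay k) (hu : LinearGrowth u) :
    LinearGrowth (k ⋆ u) := by
  obtain ⟨M, hM0, hM⟩ := hu.bound
  refine ⟨aestronglyMeasurable_convolution hk.continuous.aestronglyMeasurable hu.1,
    M * ∫ z, (1 + ‖z‖) * |k z|, by positivity, fun x => ?_⟩
  exact ((norm_integral_le_integral_norm _).trans
    (hk.integral_norm_smul_comp_sub_le hM0 hM x)).trans_eq (by ring)

theorem RapidDecay.continuous_convolution (hk : RapidDecay k) (hu : LinearGrowth u)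
    (huc : Continuous u) : Continuous (k ⋆ u) := by
  obtain ⟨M, hM0, hM⟩ := hu.bound
  have hkc := hk.continuous
  refine continuous_iff_continuousAt.2 fun x => continuousAt_of_dominated
    (bound := fun z => M * (1 + (‖x‖ + 1)) * ((1 + ‖z‖) * |k z|))
    (.of_forall fun y => Continuous.aestronglyMeasurable ?_) ?_
    (hk.integrable_one_add_norm_mul_abs.const_mul _)
    (.of_forall fun z => Continuous.continuousAt ?_)
  · simp only [ContinuousLinearMap.lsmul_apply]
    fun_prop
  · filter_upwards [continuous_norm.continuousAt.eventually_le_const (lt_add_one ‖x‖)] with y hy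
    refine .of_forall fun z => (norm_smul_comp_sub_le hM0 hM y z).trans ?_
    gcongr
  · fun_prop

theorem RapidDecay.convolution_sub (hk : RapidDecay k) (hu : LinearGrowth u)
    (hv : LinearGrowth v) : k ⋆ (u - v) = k ⋆ u - k ⋆ v := by
  ext x
  rw [Pi.sub_apply, convolution_def, convolution_def, convolution_def,
    ← integral_sub (hk.convolutionExists hu x) (hk.convolutionExists hv x)]
  simp only [Pi.sub_apply, map_sub]

theorem RapidDecay.sub_convolution {l : V → ℝ} (hk : RapidDecay k) (hl : RapidDecay l)
    (hu : LinearGrowth u) : (k - l) ⋆ u = k ⋆ u - l ⋆ u := by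
  ext x
  rw [Pi.sub_apply, convolution_def, convolution_def, convolution_def,
    ← integral_sub (hk.convolutionExists hu x) (hl.convolutionExists hu x)]
  simp only [Pi.sub_apply, map_sub, sub_apply]

theorem RapidDecay.integral_smul_convolution_comp {f : V → ℝ} {A : V → V} (hk : RapidDecay k)
    (hu : LinearGrowth u) (hf : AEStronglyMeasurable f volume)
    (hf' : Integrable fun v => (1 + ‖v‖) * f v) (hA : Continuous A) (hA' : ∀ v, ‖A v‖ ≤ ‖v‖) :
    ∫ v, f v • (k ⋆ u) (A v) = ∫ w, ∫ v, f v • k (A v - w) • u w := by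
  obtain ⟨M, hM0, hM⟩ := hu.bound
  have hmeas : AEStronglyMeasurable (fun p : V × V => f p.1 • k (A p.1 - p.2) • u p.2)
      (volume.prod volume) := by
    have hkc := hk.continuous
    exact hf.comp_fst.smul ((Continuous.aestronglyMeasurable (by fun_prop)).smul hu.1.comp_snd)
  have hint : Integrable (fun p : V × V => f p.1 • k (A p.1 - p.2) • u p.2)
      (volume.prod volume) := by
    rw [integrable_prod_iff hmeas]
    refine ⟨.of_forall fun v => ((hk.convolutionExists hu (A v)).integrable_swap).smul (f v),
      (hf'.norm.const_mul (M * ∫ z, (1 + ‖z‖) * |k z|)).mono' hmeas.norm.integral_prod_right'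
        (.of_forall fun v => ?_)⟩
    rw [Real.norm_of_nonneg (integral_nonneg fun _ => norm_nonneg _)]
    simp only [norm_smul (f v), integral_const_mul]
    rw [norm_mul, Real.norm_of_nonneg (by positivity : 0 ≤ 1 + ‖v‖)]
    have hshift : ∫ w, ‖k (A v - w) • u w‖ = ∫ z, ‖k z • u (A v - z)‖ := by
      rw [← integral_sub_left_eq_self _ volume (A v)]
      simp only [sub_sub_cancel]
    calc ‖f v‖ * ∫ w, ‖k (A v - w) • u w‖
        ≤ ‖f v‖ * (M * (1 + ‖A v‖) * ∫ z, (1 + ‖z‖) * |k z|) := by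
          rw [hshift]
          gcongr
          exact hk.integral_norm_smul_comp_sub_le hM0 hM (A v)
      _ ≤ ‖f v‖ * (M * (1 + ‖v‖) * ∫ z, (1 + ‖z‖) * |k z|) := by
          gcongr
          exact hA' v
      _ = _ := by ring
  rw [← integral_integral_swap hint]
  simp only [convolution_lsmul_swap, integral_smul]

theorem RapidDecay.integral_smul_convolution_comp_eq_zero [CompleteSpace F] {f : V → ℝ} {A : V → V}
    (hk : RapidDecay k) (hu : LinearGrowth u) (hf : AEStronglyMeasurable f volume)
    (hf' : Integrable fun v => (1 + ‖v‖) * f v) (hA : Continuous A) (hA' : ∀ v, ‖A v‖ ≤ ‖v‖)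
    (h : ∀ w, ∫ v, f v * k (A v - w) = 0) : ∫ v, f v • (k ⋆ u) (A v) = 0 := by
  rw [hk.integral_smul_convolution_comp hu hf hf' hA hA']
  refine integral_eq_zero_of_ae (.of_forall fun w => ?_)
  simp only [← mul_smul, integral_smul_const, h w, zero_smul, Pi.zero_apply]

end RapidDecay

section Dilation

variable {V F : Type*} [NormedAddCommGroup V] [InnerProductSpace ℝ V] [FiniteDimensional ℝ V]
  [MeasurableSpace V] [BorelSpace V] [NormedAddCommGroup F]

/-- The `L¹`-normalised dilation `c ^ d * k (c x)` of a kernel `k` on a `d`-dimensional space. -/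
def dilate (c : ℝ) (k : V → ℝ) (x : V) : ℝ := c ^ Module.finrank ℝ V * k (c • x)

variable {k : V → ℝ} {u : V → F} {c : ℝ}

theorem eLpNorm_dilate_one (hc : 0 < c) (k : V → ℝ) :
    eLpNorm (dilate c k) 1 volume = eLpNorm k 1 volume := by
  have hcd : 0 < c ^ Module.finrank ℝ V := pow_pos hc _
  have hmap := Measure.map_addHaar_smul (volume : Measure V) hc.ne'
  have hcomp := (Homeomorph.smulOfNeZero c hc.ne').measurableEmbedding.lintegral_map
    (μ := (volume : Measure V)) (fun z => ‖k z‖ₑ)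
  rw [eLpNorm_one_eq_lintegral_enorm, eLpNorm_one_eq_lintegral_enorm]
  simp only [dilate, enorm_mul]
  rw [lintegral_const_mul' _ _ enorm_ne_top]
  change ∫⁻ z, ‖k z‖ₑ ∂Measure.map (fun x => c • x) volume = ∫⁻ z, ‖k (c • z)‖ₑ at hcomp
  rw [← hcomp, hmap, lintegral_smul_measure, abs_of_pos (inv_pos.2 hcd), smul_eq_mul, ← mul_assoc,
    Real.enorm_of_nonneg hcd.le, ← ENNReal.ofReal_mul hcd.le, mul_inv_cancel₀ hcd.ne',
    ENNReal.ofReal_one, one_mul]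

variable [NormedSpace ℝ F]

theorem dilate_convolution_apply (hc : 0 < c) (k : V → ℝ) (u : V → F) (x : V) :
    (dilate c k ⋆ u) x = ∫ z, k z • u (x - c⁻¹ • z) := by
  have hcd : 0 < c ^ Module.finrank ℝ V := pow_pos hc _
  have h := Measure.integral_comp_smul (volume : Measure V) (fun z => k z • u (x - c⁻¹ • z)) c
  simp only [smul_smul, inv_mul_cancel₀ hc.ne', one_smul] at h
  simp only [convolution_def, ContinuousLinearMap.lsmul_apply, dilate, mul_smul]
  rw [integral_smul, h, abs_of_pos (inv_pos.2 hcd), smul_inv_smul₀ hcd.ne']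

theorem RapidDecay.tendsto_dilate_convolution [CompleteSpace F] (hk : RapidDecay k)
    (hu : LinearGrowth u) (huc : Continuous u) (x : V) :
    Tendsto (fun c : ℝ => (dilate c k ⋆ u) x) atTop (𝓝 ((∫ z, k z) • u x)) := by
  obtain ⟨M, hM0, hM⟩ := hu.bound
  have hkc := hk.continuous
  rw [← integral_smul_const]
  refine (tendsto_integral_filter_of_dominated_convergence
    (F := fun (c : ℝ) z => k z • u (x - c⁻¹ • z)) (fun z => M * (1 + ‖x‖) * ((1 + ‖z‖) * |k z|))
    (.of_forall fun c => Continuous.aestronglyMeasurable (by fun_prop)) ?_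
    (hk.integrable_one_add_norm_mul_abs.const_mul _) (.of_forall fun z => ?_)).congr' ?_
  · filter_upwards [eventually_ge_atTop 1] with c hc
    refine .of_forall fun z => ?_
    have hcz : ‖c⁻¹ • z‖ ≤ ‖z‖ := by
      rw [norm_smul, Real.norm_of_nonneg (by positivity)]
      exact mul_le_of_le_one_left (norm_nonneg z) (inv_le_one_of_one_le₀ hc)
    rw [norm_smul, Real.norm_eq_abs]
    calc |k z| * ‖u (x - c⁻¹ • z)‖ ≤ |k z| * (M * ((1 + ‖x‖) * (1 + ‖z‖))) := by
          gcongr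
          refine (hM _).trans ?_
          gcongr
          exact (one_add_norm_sub_le _ _).trans (by gcongr)
      _ = _ := by ring
  · have hlim : Tendsto (fun c : ℝ => x - c⁻¹ • z) atTop (𝓝 x) := by
      simpa using ((tendsto_inv_atTop_zero (𝕜 := ℝ)).smul_const z).const_sub x
    exact ((huc.tendsto x).comp hlim).const_smul _
  · filter_upwards [eventually_gt_atTop 0] with c hc
    exact (dilate_convolution_apply hc k u x).symm

end Dilation

section Stretch

variable {V : Type*} [NormedAddCommGroup V] [InnerProductSpace ℝ V] {e : V}

/-- The linear map that multiplies the component along the unit vector `e` by `t` and fixes the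
orthogonal complement of `e`. -/
def stretch (e : V) (t : ℝ) : V →L[ℝ] V :=
  ContinuousLinearMap.id ℝ V + (t - 1) • (innerSL ℝ e).smulRight e

theorem stretch_apply (e : V) (t : ℝ) (x : V) :
    stretch e t x = x + ((t - 1) * inner ℝ e x) • e := by
  simp [stretch, mul_smul]

theorem stretch_one_apply (e x : V) : stretch e 1 x = x := by simp [stretch_apply]

theorem continuous_stretch_uncurry (e : V) : Continuous fun p : ℝ × V => stretch e p.1 p.2 := by
  simp only [stretch_apply]
  fun_prop

theorem inner_stretch_left (e : V) (t : ℝ) (x y : V) :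
    inner ℝ (stretch e t x) y = inner ℝ x (stretch e t y) := by
  simp only [stretch_apply, inner_add_left, inner_add_right, real_inner_smul_left,
    real_inner_smul_right, real_inner_comm e x]
  ring

theorem adjoint_stretch [CompleteSpace V] (e : V) (t : ℝ) :
    (stretch e t).adjoint = stretch e t :=
  ((stretch e t).eq_adjoint_iff _).2 (inner_stretch_left e t) |>.symm

theorem inner_stretch_self (he : ‖e‖ = 1) (t : ℝ) (x : V) :
    inner ℝ e (stretch e t x) = t * inner ℝ e x := by
  rw [stretch_apply, inner_add_right, real_inner_smul_right, real_inner_self_eq_norm_sq, he]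
  ring

theorem norm_stretch_le (he : ‖e‖ = 1) {t : ℝ} (ht : |t| ≤ 1) (x : V) : ‖stretch e t x‖ ≤ ‖x‖ := by
  have h : ‖stretch e t x‖ ^ 2 = ‖x‖ ^ 2 - (1 - t ^ 2) * inner ℝ e x ^ 2 := by
    rw [stretch_apply, norm_add_sq_real, norm_smul, he, Real.norm_eq_abs, mul_one, sq_abs,
      real_inner_smul_right, real_inner_comm]
    ring
  have ht2 : t ^ 2 ≤ 1 := (sq_le_one_iff_abs_le_one t).2 ht
  refine le_of_sq_le_sq ?_ (norm_nonneg x)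
  rw [h]
  nlinarith [mul_nonneg (sub_nonneg.2 ht2) (sq_nonneg (inner ℝ e x : ℝ))]

theorem reflection_stretch_zero (he : ‖e‖ = 1) (x : V) :
    (ℝ ∙ e)ᗮ.reflection (stretch e 0 x) = stretch e 0 x := by
  refine Submodule.reflection_mem_subspace_eq_self
    (Submodule.mem_orthogonal_singleton_iff_inner_right.2 ?_)
  rw [inner_stretch_self he, zero_mul]

theorem reflection_orthogonal_singleton_apply (he : ‖e‖ = 1) (x : V) :
    (ℝ ∙ e)ᗮ.reflection x = x - (2 * inner ℝ e x) • e := by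
  rw [Submodule.reflection_orthogonal_apply, Submodule.reflection_singleton_apply, he]
  simp [mul_smul, two_smul]

theorem hasDerivAt_stretch_sub (e x y : V) (t : ℝ) :
    HasDerivAt (fun t => stretch e t x - y) ((inner ℝ e x : ℝ) • e) t := by
  simp only [stretch_apply]
  have h : HasDerivAt (fun t : ℝ => (t - 1) * (inner ℝ e x : ℝ)) (inner ℝ e x) t := by
    simpa using ((hasDerivAt_id t).sub_const 1).mul_const (inner ℝ e x : ℝ)
  exact ((h.smul_const e).const_add x).sub_const y

end Stretch

section OddAlong

variable {V : Type*} [NormedAddCommGroup V] [InnerProductSpace ℝ V]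

/-- Continuous functions that are odd under the reflection in the hyperplane orthogonal to `e` and
grow at most like the distance to that hyperplane. -/
structure OddAlong (e : V) (M : ℝ) (u : V → ℝ) : Prop where
  continuous : Continuous u
  nonneg : 0 ≤ M
  bound : ∀ y, |u y| ≤ M * |inner ℝ e y|
  odd : ∀ y, u ((ℝ ∙ e)ᗮ.reflection y) = -u y

variable {e : V} {M : ℝ} {u k : V → ℝ}

theorem OddAlong.comp_inv_smul (hu : OddAlong e M u) {c : ℝ} (hc : 0 < c) :
    OddAlong e (M * c⁻¹) fun y => u (c⁻¹ • y) where
  continuous := hu.continuous.comp (continuous_const_smul _)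
  nonneg := mul_nonneg hu.nonneg (inv_nonneg.2 hc.le)
  bound y := by
    refine (hu.bound _).trans_eq ?_
    rw [real_inner_smul_right, abs_mul, abs_of_pos (inv_pos.2 hc), mul_assoc]
  odd y := by rw [← map_smul, hu.odd]

variable [FiniteDimensional ℝ V] [MeasurableSpace V] [BorelSpace V]

/-- Differentiable convolution kernels that are even under the reflection in the hyperplane
orthogonal to `e` and decay rapidly together with their derivative along `e`. -/
structure EvenKernel (e : V) (k : V → ℝ) : Prop where
  differentiable : Differentiable ℝ k
  rapidDecay : RapidDecay k
  rapidDecay_fderiv : RapidDecay fun x => fderiv ℝ k x e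
  even : ∀ x, k ((ℝ ∙ e)ᗮ.reflection x) = k x

theorem OddAlong.linearGrowth (hu : OddAlong e M u) (he : ‖e‖ = 1) : LinearGrowth u :=
  .of_norm_le_inner hu.continuous.aestronglyMeasurable hu.nonneg he hu.bound

theorem OddAlong.convolution_stretch_zero (hu : OddAlong e M u) (he : ‖e‖ = 1)
    (hk : ∀ x, k ((ℝ ∙ e)ᗮ.reflection x) = k x) (x : V) : (k ⋆ u) (stretch e 0 x) = 0 := by
  suffices h : (k ⋆ u) (stretch e 0 x) = -(k ⋆ u) (stretch e 0 x) by linarith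
  have hrefl := (ℝ ∙ e)ᗮ.reflection.measurePreserving.integral_comp
    (ℝ ∙ e)ᗮ.reflection.toHomeomorph.measurableEmbedding
    (fun y => k (stretch e 0 x - y) • u y)
  rw [convolution_lsmul_swap, ← integral_neg, ← hrefl]
  refine integral_congr_ae (.of_forall fun y => ?_)
  simp only [hu.odd, smul_neg]
  rw [← hk (stretch e 0 x - y), map_sub, reflection_stretch_zero he]

theorem EvenKernel.sub_stretch_zero_eq_integral (hk : EvenKernel e k) (x y : V) :
    k (x - y) - k (stretch e 0 x - y) =
      ∫ t in Set.Ioc (0 : ℝ) 1, inner ℝ e x * fderiv ℝ k (stretch e t x - y) e := by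
  have hderiv (t : ℝ) : HasDerivAt (fun t => k (stretch e t x - y))
      (inner ℝ e x * fderiv ℝ k (stretch e t x - y) e) t := by
    rw [← smul_eq_mul, ← map_smul]
    exact (hk.differentiable (stretch e t x - y)).hasFDerivAt.comp_hasDerivAt t
      (hasDerivAt_stretch_sub e x y t)
  have hcont : Continuous fun t : ℝ => inner ℝ e x * fderiv ℝ k (stretch e t x - y) e := by
    have hs : Continuous fun t : ℝ => stretch e t x :=
      (continuous_stretch_uncurry e).comp (Continuous.prodMk_left x)
    exact continuous_const.mul (hk.rapidDecay_fderiv.continuous.comp (hs.sub continuous_const))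
  rw [← intervalIntegral.integral_of_le zero_le_one,
    intervalIntegral.integral_eq_sub_of_hasDerivAt (fun t _ => hderiv t)
      (hcont.intervalIntegrable _ _), stretch_one_apply]

theorem RapidDecay.integrable_comp_stretch_sub_mul {l : V → ℝ} (hl : RapidDecay l)
    (hu : LinearGrowth u) (huc : Continuous u) (he : ‖e‖ = 1) (x : V) :
    Integrable (fun p : V × ℝ => l (stretch e p.2 x - p.1) * u p.1)
      (volume.prod (volume.restrict (Set.Ioc (0 : ℝ) 1))) := by
  obtain ⟨M, hM0, hM⟩ := hu.bound
  have hmeas : AEStronglyMeasurable (fun p : V × ℝ => l (stretch e p.2 x - p.1) * u p.1)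
      (volume.prod (volume.restrict (Set.Ioc (0 : ℝ) 1))) := by
    have hs : Continuous fun p : V × ℝ => stretch e p.2 x :=
      (continuous_stretch_uncurry e).comp (continuous_snd.prodMk continuous_const)
    exact ((hl.continuous.comp (hs.sub continuous_fst)).mul
      (huc.comp continuous_fst)).aestronglyMeasurable
  refine (integrable_prod_iff' hmeas).2 ⟨.of_forall fun t =>
    (hl.convolutionExists hu (stretch e t x)).integrable_swap,
    (integrable_const (M * (1 + ‖x‖) * ∫ z, (1 + ‖z‖) * |l z|)).mono'
      hmeas.norm.prod_swap.integral_prod_right' ?_⟩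
  filter_upwards [ae_restrict_mem measurableSet_Ioc] with t ht
  have hshift : ∫ y, ‖l (stretch e t x - y) * u y‖ = ∫ z, ‖l z • u (stretch e t x - z)‖ := by
    rw [← integral_sub_left_eq_self _ volume (stretch e t x)]
    simp only [sub_sub_cancel, smul_eq_mul]
  rw [Real.norm_of_nonneg (integral_nonneg fun _ => norm_nonneg _), hshift]
  refine (hl.integral_norm_smul_comp_sub_le hM0 hM _).trans ?_
  gcongr
  exact norm_stretch_le he (abs_le.2 ⟨by linarith [ht.1], ht.2⟩) x

-- An odd field convolved with an even kernel vanishes on the hyperplane orthogonal to `e`, and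
-- dividing by `⟪e, x⟫` amounts to averaging the derivative along the segment to that hyperplane.
theorem OddAlong.convolution_eq_inner_mul (hu : OddAlong e M u) (hk : EvenKernel e k)
    (he : ‖e‖ = 1) (x : V) :
    (k ⋆ u) x = inner ℝ e x *
      ∫ t in Set.Ioc (0 : ℝ) 1, ((fun z => fderiv ℝ k z e) ⋆ u) (stretch e t x) := by
  have hlg := hu.linearGrowth he
  have hint (z : V) : Integrable fun y => k (z - y) * u y :=
    (hk.rapidDecay.convolutionExists hlg z).integrable_swap
  calc (k ⋆ u) x = (k ⋆ u) x - (k ⋆ u) (stretch e 0 x) := by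
        rw [hu.convolution_stretch_zero he hk.even, sub_zero]
    _ = ∫ y, (k (x - y) - k (stretch e 0 x - y)) * u y := by
        simp only [convolution_lsmul_swap, smul_eq_mul, sub_mul]
        rw [integral_sub (hint x) (hint _)]
    _ = ∫ y, inner ℝ e x * ∫ t in Set.Ioc (0 : ℝ) 1, fderiv ℝ k (stretch e t x - y) e * u y := by
        simp only [hk.sub_stretch_zero_eq_integral, integral_const_mul, integral_mul_const,
          mul_assoc]
    _ = _ := by
        simp only [integral_const_mul, convolution_lsmul_swap, smul_eq_mul]
        rw [integral_integral_swap
          (hk.rapidDecay_fderiv.integrable_comp_stretch_sub_mul hlg hu.continuous he x)]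

theorem OddAlong.abs_convolution_le (hu : OddAlong e M u) (he : ‖e‖ = 1) {l : V → ℝ}
    (hl : RapidDecay l) {x : V} {a : ℝ} (ha : 1 ≤ a) (hx : |inner ℝ e x| ≤ a) :
    |(l ⋆ u) x| ≤ M * a * ∫ z, (1 + ‖z‖) * |l z| := by
  have hM := hu.nonneg
  rw [← integral_const_mul]
  change ‖∫ z, l z • u (x - z)‖ ≤ _
  refine norm_integral_le_of_norm_le (hl.integrable_one_add_norm_mul_abs.const_mul _)
    (.of_forall fun z => ?_)
  have hez : |inner ℝ e (x - z)| ≤ a * (1 + ‖z‖) := by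
    have := abs_real_inner_le_norm e z
    rw [he, one_mul] at this
    rw [inner_sub_right]
    nlinarith [abs_sub (inner ℝ e x : ℝ) (inner ℝ e z), norm_nonneg z]
  calc ‖l z • u (x - z)‖ = |l z| * |u (x - z)| := by rw [norm_smul]; rfl
    _ ≤ |l z| * (M * (a * (1 + ‖z‖))) := by
        gcongr
        exact (hu.bound _).trans (by gcongr)
    _ = _ := by ring

theorem EvenKernel.exists_abs_convolution_le (hk : EvenKernel e k) (he : ‖e‖ = 1) :
    ∃ C : ℝ, 0 ≤ C ∧ ∀ (M : ℝ) (u : V → ℝ), OddAlong e M u →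
      ∀ x, |(k ⋆ u) x| ≤ C * M * |inner ℝ e x| := by
  set I := ∫ z, (1 + ‖z‖) * |k z|
  set J := ∫ z, (1 + ‖z‖) * |fderiv ℝ k z e|
  have hI : 0 ≤ I := integral_nonneg fun z => by positivity
  have hJ : 0 ≤ J := integral_nonneg fun z => by positivity
  refine ⟨I + J, by positivity, fun M u hu x => ?_⟩
  have hM := hu.nonneg
  rcases le_total 1 |inner ℝ e x| with hx | hx
  · calc |(k ⋆ u) x| ≤ M * |inner ℝ e x| * I := hu.abs_convolution_le he hk.rapidDecay hx le_rfl
      _ = I * M * |inner ℝ e x| := by ring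
      _ ≤ _ := by gcongr; linarith
  · have hD : ∀ t ∈ Set.Ioc (0 : ℝ) 1,
        ‖((fun z => fderiv ℝ k z e) ⋆ u) (stretch e t x)‖ ≤ M * 1 * J := fun t ht => by
      refine hu.abs_convolution_le he hk.rapidDecay_fderiv le_rfl ?_
      rw [inner_stretch_self he, abs_mul, abs_of_pos ht.1]
      exact mul_le_one₀ ht.2 (abs_nonneg _) hx
    have havg := norm_setIntegral_le_of_norm_le_const (μ := volume) (by simp) hD
    rw [Real.norm_eq_abs, Real.volume_real_Ioc_of_le zero_le_one, sub_zero, mul_one, mul_one]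
      at havg
    rw [hu.convolution_eq_inner_mul hk he, abs_mul]
    calc _ ≤ |inner ℝ e x| * (M * J) := by gcongr
      _ = J * M * |inner ℝ e x| := by ring
      _ ≤ _ := by gcongr; linarith

theorem EvenKernel.exists_abs_dilate_convolution_le (hk : EvenKernel e k) (he : ‖e‖ = 1) :
    ∃ C : ℝ, 0 ≤ C ∧ ∀ (c : ℝ) (M : ℝ) (u : V → ℝ), 0 < c → OddAlong e M u →
      ∀ x, |(dilate c k ⋆ u) x| ≤ C * M * |inner ℝ e x| := by
  obtain ⟨C, hC, h⟩ := hk.exists_abs_convolution_le he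
  refine ⟨C, hC, fun c M u hc hu x => ?_⟩
  have hscale : (dilate c k ⋆ u) x = (k ⋆ fun y => u (c⁻¹ • y)) (c • x) := by
    simp only [dilate_convolution_apply hc, convolution_def, ContinuousLinearMap.lsmul_apply,
      smul_sub, inv_smul_smul₀ hc.ne']
  calc |(dilate c k ⋆ u) x| ≤ C * (M * c⁻¹) * |inner ℝ e (c • x)| := by
        rw [hscale]
        exact h _ _ (hu.comp_inv_smul hc) _
    _ = C * M * |inner ℝ e x| := by
        rw [real_inner_smul_right, abs_mul, abs_of_pos hc]
        field_simp

end OddAlong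

section SpectralLocalization

variable {V : Type*} [NormedAddCommGroup V] [InnerProductSpace ℝ V] [FiniteDimensional ℝ V]
  [MeasurableSpace V] [BorelSpace V]

open Real in
theorem integral_comp_sub_mul_fourierChar (K : V → ℂ) (A : V →L[ℝ] V) (ξ η x y w : V) :
    ∫ v, K (x - v) * ((𝐞 (inner ℝ ξ (A v - y)) : ℂ) * 𝐞 (inner ℝ η (v - w))) =
      𝐞 (inner ℝ (A.adjoint ξ + η) x - inner ℝ ξ y - inner ℝ η w) * 𝓕 K (A.adjoint ξ + η) := by
  rw [Real.fourier_eq, ← integral_sub_left_eq_self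
    (fun v => 𝐞 (-inner ℝ v (A.adjoint ξ + η)) • K v) volume x, ← integral_const_mul]
  refine integral_congr_ae (.of_forall fun v => ?_)
  have hphase : inner ℝ ξ (A v - y) + inner ℝ η (v - w) =
      (inner ℝ (A.adjoint ξ + η) x - inner ℝ ξ y - inner ℝ η w) +
        -inner ℝ (x - v) (A.adjoint ξ + η) := by
    rw [real_inner_comm _ (x - v)]
    simp only [inner_sub_right, inner_add_left, ContinuousLinearMap.adjoint_inner_left]
    ring
  have hchar := congrArg (fun r => (𝐞 r : ℂ)) hphase
  simp only [AddChar.map_add_eq_mul, Circle.coe_mul] at hchar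
  simp only [Circle.smul_def, smul_eq_mul, hchar]
  ring

-- The product of `𝓕⁻ m₁ ∘ A` and `𝓕⁻ m₂` has its spectrum in `Aᵀ (supp m₁) + supp m₂`.
theorem integral_mul_fourierInv_comp_mul_fourierInv_eq_zero {K m₁ m₂ : V → ℂ} (hK : Integrable K)
    (h₁ : Integrable m₁) (h₂ : Integrable m₂) (A : V →L[ℝ] V) (x y w : V)
    (h : ∀ ξ η, m₁ ξ ≠ 0 → m₂ η ≠ 0 → 𝓕 K (A.adjoint ξ + η) = 0) :
    ∫ v, K (x - v) * (𝓕⁻ m₁ (A v - y) * 𝓕⁻ m₂ (v - w)) = 0 := by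
  set F : V → V × V → ℂ := fun v ζ =>
    (m₁ ζ.1 * m₂ ζ.2) * (K (x - v) * ((Real.fourierChar (inner ℝ ζ.1 (A v - y)) : ℂ) *
      Real.fourierChar (inner ℝ ζ.2 (v - w)))) with hF
  have hFint : Integrable (Function.uncurry F) (volume.prod (volume.prod volume)) := by
    have hprod := (hK.comp_sub_left x).mul_prod (h₁.mul_prod h₂)
    refine (hprod.bdd_mul (c := 1) (f := fun ζ : V × V × V =>
      (Real.fourierChar (inner ℝ ζ.2.1 (A ζ.1 - y)) : ℂ) *
        Real.fourierChar (inner ℝ ζ.2.2 (ζ.1 - w)))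
      (Continuous.aestronglyMeasurable (by fun_prop))
      (.of_forall fun ζ => by rw [norm_mul, Circle.norm_coe, Circle.norm_coe, one_mul])).congr
      (.of_forall fun ζ => ?_)
    simp only [hF, Function.uncurry]
    ring
  have hFzero (ζ : V × V) : ∫ v, F v ζ = 0 := by
    simp only [hF]
    rw [integral_const_mul, integral_comp_sub_mul_fourierChar]
    by_cases hζ₁ : m₁ ζ.1 = 0
    · simp [hζ₁]
    by_cases hζ₂ : m₂ ζ.2 = 0
    · simp [hζ₂]
    rw [h _ _ hζ₁ hζ₂, mul_zero, mul_zero]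
  calc ∫ v, K (x - v) * (𝓕⁻ m₁ (A v - y) * 𝓕⁻ m₂ (v - w))
      = ∫ v, ∫ ζ, F v ζ ∂(volume.prod volume) := by
        refine integral_congr_ae (.of_forall fun v => ?_)
        dsimp only
        rw [Real.fourierInv_eq, Real.fourierInv_eq, ← integral_prod_mul, ← integral_const_mul]
        refine integral_congr_ae (.of_forall fun ζ => ?_)
        simp only [hF, Circle.smul_def, smul_eq_mul]
        ring
    _ = ∫ ζ, ∫ v, F v ζ ∂volume ∂(volume.prod volume) := integral_integral_swap hFint
    _ = 0 := by simp only [hFzero, integral_zero]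

variable {K k l u : V → ℝ} {e : V} {M : ℝ}

theorem RapidDecay.integrable_comp_sub_left_mul (hK : RapidDecay K) {f : V → ℝ}
    (hf : AEStronglyMeasurable f volume) {B : ℝ} {n : ℕ} (hB : ∀ v, |f v| ≤ B * (1 + ‖v‖) ^ n)
    (x : V) : Integrable fun v => K (x - v) * f v := by
  have hKc := hK.continuous
  refine ((hK.integrable_pow_mul_comp_sub_left n x).norm.const_mul B).mono'
    ((Continuous.aestronglyMeasurable (by fun_prop)).mul hf) (.of_forall fun v => ?_)
  rw [norm_mul, norm_mul, norm_pow, Real.norm_of_nonneg (by positivity : 0 ≤ 1 + ‖v‖)]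
  calc ‖K (x - v)‖ * ‖f v‖ ≤ ‖K (x - v)‖ * (B * (1 + ‖v‖) ^ n) := by gcongr; exact hB v
    _ = _ := by ring

theorem integral_mul_convolution_mul_convolution_comp_eq_zero (hK : RapidDecay K)
    (hk : RapidDecay k) (hl : RapidDecay l) (hu : LinearGrowth u) {A : V → V} (hA : Continuous A)
    (hA' : ∀ v, ‖A v‖ ≤ ‖v‖) (x : V)
    (h : ∀ w w', ∫ v, K (x - v) * l (A v - w) * k (v - w') = 0) :
    ∫ v, K (x - v) * (k ⋆ u) v * (l ⋆ u) (A v) = 0 := by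
  have hKc := hK.continuous
  have hlc := hl.continuous
  obtain ⟨hSm, B, -, hB⟩ := hk.linearGrowth_convolution hu
  obtain ⟨Q, hQ⟩ := hl.bounded
  refine hl.integral_smul_convolution_comp_eq_zero
    (f := fun v => K (x - v) * (k ⋆ u) v) hu
    ((Continuous.aestronglyMeasurable (by fun_prop)).mul hSm) ?_ hA hA' fun w => ?_
  · refine (hK.integrable_comp_sub_left_mul (f := fun v => (1 + ‖v‖) * (k ⋆ u) v) (n := 2) (B := B)
      ((Continuous.aestronglyMeasurable (by fun_prop)).mul hSm) (fun v => ?_) x).congr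
      (.of_forall fun v => by ring)
    rw [abs_mul, abs_of_nonneg (by positivity : 0 ≤ 1 + ‖v‖)]
    calc (1 + ‖v‖) * |(k ⋆ u) v| ≤ (1 + ‖v‖) * (B * (1 + ‖v‖)) := by gcongr; exact hB v
      _ = B * (1 + ‖v‖) ^ 2 := by ring
  · have hswap := hk.integral_smul_convolution_comp_eq_zero
      (f := fun v => K (x - v) * l (A v - w)) hu (Continuous.aestronglyMeasurable (by fun_prop)) ?_
      continuous_id (fun v => le_rfl) (h w)
    · rw [← hswap]
      refine integral_congr_ae (.of_forall fun v => ?_)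
      simp only [smul_eq_mul, id]
      ring
    · refine (hK.integrable_comp_sub_left_mul (f := fun v => (1 + ‖v‖) * l (A v - w)) (n := 1)
        (B := Q) (Continuous.aestronglyMeasurable (by fun_prop)) (fun v => ?_) x).congr
        (.of_forall fun v => by ring)
      rw [abs_mul, abs_of_nonneg (by positivity : 0 ≤ 1 + ‖v‖), pow_one, mul_comm]
      gcongr
      exact hQ _

theorem integrable_mul_convolution_mul_convolution_stretch (hK : RapidDecay K)
    (hk : RapidDecay k) (hl : RapidDecay l) (hu : LinearGrowth u) (huc : Continuous u)
    (he : ‖e‖ = 1) (x : V) :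
    Integrable (fun p : V × ℝ => K (x - p.1) * (k ⋆ u) p.1 * (l ⋆ u) (stretch e p.2 p.1))
      (volume.prod (volume.restrict (Set.Ioc (0 : ℝ) 1))) := by
  have hKc := hK.continuous
  have hS := hk.continuous_convolution hu huc
  have hD := hl.continuous_convolution hu huc
  obtain ⟨-, B, hB0, hB⟩ := hk.linearGrowth_convolution hu
  obtain ⟨-, B', hB0', hB'⟩ := hl.linearGrowth_convolution hu
  have hst : Continuous fun p : V × ℝ => stretch e p.2 p.1 :=
    (continuous_stretch_uncurry e).comp continuous_swap
  refine (((hK.integrable_pow_mul_comp_sub_left 2 x).norm.const_mul (B * B')).mul_prod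
    (integrable_const (μ := volume.restrict (Set.Ioc (0 : ℝ) 1)) (1 : ℝ))).mono'
    (Continuous.aestronglyMeasurable (by fun_prop)) ?_
  filter_upwards [Measure.quasiMeasurePreserving_snd.ae (ae_restrict_mem measurableSet_Ioc)]
    with p hp
  have hDp : ‖(l ⋆ u) (stretch e p.2 p.1)‖ ≤ B' * (1 + ‖p.1‖) := by
    refine (hB' _).trans ?_
    gcongr
    exact norm_stretch_le he (abs_le.2 ⟨by linarith [hp.1], hp.2⟩) p.1
  rw [norm_mul, norm_mul, norm_mul, norm_pow, Real.norm_of_nonneg (by positivity : 0 ≤ 1 + ‖p.1‖)]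
  calc ‖K (x - p.1)‖ * ‖(k ⋆ u) p.1‖ * ‖(l ⋆ u) (stretch e p.2 p.1)‖
      ≤ ‖K (x - p.1)‖ * (B * (1 + ‖p.1‖)) * (B' * (1 + ‖p.1‖)) := by
        gcongr
        exact hB _
    _ = _ := by ring

theorem OddAlong.convolution_convolution_sq_div_eq_zero (hu : OddAlong e M u)
    (hk : EvenKernel e k) (hK : RapidDecay K) (he : ‖e‖ = 1) (x : V)
    (h : ∀ t ∈ Set.Ioc (0 : ℝ) 1, ∀ w w',
      ∫ v, K (x - v) * fderiv ℝ k (stretch e t v - w) e * k (v - w') = 0) :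
    (K ⋆ fun v => (k ⋆ u) v ^ 2 / inner ℝ e v) x = 0 := by
  have hlg := hu.linearGrowth he
  have hdiv (v : V) : (k ⋆ u) v ^ 2 / inner ℝ e v = (k ⋆ u) v *
      ∫ t in Set.Ioc (0 : ℝ) 1, ((fun z => fderiv ℝ k z e) ⋆ u) (stretch e t v) := by
    have hv := hu.convolution_eq_inner_mul hk he v
    by_cases hev : (inner ℝ e v : ℝ) = 0
    · rw [hev, zero_mul] at hv
      simp [hv]
    · rw [div_eq_iff hev, sq, mul_assoc, mul_comm _ (inner ℝ e v), ← hv]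
  rw [convolution_lsmul_swap]
  simp only [hdiv, smul_eq_mul, ← mul_assoc, ← integral_const_mul]
  rw [integral_integral_swap (integrable_mul_convolution_mul_convolution_stretch hK hk.rapidDecay
    hk.rapidDecay_fderiv hlg hu.continuous he x)]
  refine setIntegral_eq_zero_of_forall_eq_zero fun t ht => ?_
  exact integral_mul_convolution_mul_convolution_comp_eq_zero hK hk.rapidDecay
    hk.rapidDecay_fderiv hlg (stretch e t).continuous
    (norm_stretch_le he (abs_le.2 ⟨by linarith [ht.1], ht.2⟩)) x (h t ht)

end SpectralLocalization

section Symbols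

open scoped LineDeriv

theorem RapidDecay.re_schwartzMap {V : Type*} [NormedAddCommGroup V] [InnerProductSpace ℝ V]
    [FiniteDimensional ℝ V] [MeasurableSpace V] [BorelSpace V] (f : SchwartzMap V ℂ) :
    RapidDecay fun x => (f x).re := by
  have hc : Continuous fun x => (f x).re := Complex.continuous_re.comp f.continuous
  refine ⟨hc, fun n => ?_, SchwartzMap.seminorm ℝ 0 0 f, fun x =>
    (Complex.abs_re_le_norm _).trans (SchwartzMap.norm_le_seminorm ℝ f x)⟩
  have hint : Integrable fun x => (2 : ℝ) ^ (n - 1) * (‖x‖ ^ 0 * ‖f x‖ + ‖x‖ ^ n * ‖f x‖) :=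
    ((f.integrable_pow_mul volume 0).add (f.integrable_pow_mul volume n)).const_mul _
  refine hint.mono' (by fun_prop) (.of_forall fun x => ?_)
  rw [norm_mul, norm_pow, Real.norm_of_nonneg (by positivity : 0 ≤ 1 + ‖x‖), Real.norm_eq_abs]
  calc (1 + ‖x‖) ^ n * |(f x).re| ≤ (2 ^ (n - 1) * (1 ^ n + ‖x‖ ^ n)) * ‖f x‖ := by
        gcongr
        · exact add_pow_le zero_le_one (norm_nonneg x) n
        · exact Complex.abs_re_le_norm _
    _ = _ := by ring

/-- Smooth compactly supported radial Fourier symbols, such as the cut-offs of a dyadic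
partition. -/
structure IsSymbol (m : E3 → ℝ) : Prop where
  contDiff : ContDiff ℝ ∞ m
  hasCompactSupport : HasCompactSupport m
  radial : ∀ ξ η : E3, ‖ξ‖ = ‖η‖ → m ξ = m η

theorem IsSymbol.zero : IsSymbol 0 :=
  ⟨contDiff_const, HasCompactSupport.zero, fun _ _ _ => rfl⟩

variable {m μ : E3 → ℝ}

theorem IsSymbol.sub (hm : IsSymbol m) (hμ : IsSymbol μ) : IsSymbol (m - μ) where
  contDiff := hm.contDiff.sub hμ.contDiff
  hasCompactSupport := hm.hasCompactSupport.sub hμ.hasCompactSupport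
  radial ξ η h := congrArg₂ (· - ·) (hm.radial ξ η h) (hμ.radial ξ η h)

theorem IsSymbol.comp_smul (hm : IsSymbol m) {c : ℝ} (hc : c ≠ 0) :
    IsSymbol fun ξ => m (c • ξ) where
  contDiff := hm.contDiff.comp (contDiff_const_smul c)
  hasCompactSupport := hm.hasCompactSupport.comp_homeomorph (Homeomorph.smulOfNeZero c hc)
  radial ξ η h := hm.radial _ _ (by rw [norm_smul, norm_smul, h])

/-- A Fourier symbol as a complex Schwartz function. -/
def IsSymbol.schwartz (hm : IsSymbol m) : SchwartzMap E3 ℂ :=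
  HasCompactSupport.toSchwartzMap (f := fun ξ => (m ξ : ℂ))
    (hm.hasCompactSupport.comp_left (g := Complex.ofReal) rfl)
    (Complex.ofRealCLM.contDiff.comp hm.contDiff)

theorem IsSymbol.schwartz_apply (hm : IsSymbol m) (ξ : E3) : hm.schwartz ξ = (m ξ : ℂ) := rfl

theorem IsSymbol.integrable_ofReal (hm : IsSymbol m) : Integrable fun ξ => (m ξ : ℂ) :=
  hm.schwartz.integrable

theorem IsSymbol.fourierInv_isometry (hm : IsSymbol m) (A : E3 ≃ₗᵢ[ℝ] E3) (x : E3) :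
    𝓕⁻ (fun ξ : E3 => (m ξ : ℂ)) (A x) = 𝓕⁻ (fun ξ : E3 => (m ξ : ℂ)) x := by
  rw [← Real.fourierInv_comp_linearIsometry]
  exact congrArg (fun f : E3 → ℂ => 𝓕⁻ f x)
    (funext fun ξ => congrArg Complex.ofReal (hm.radial (A ξ) ξ (A.norm_map ξ)))

-- The symbol is real and even, so that its inverse Fourier transform is real.
theorem IsSymbol.ofReal_kernel (hm : IsSymbol m) (x : E3) :
    (kernel m x : ℂ) = 𝓕⁻ (fun ξ : E3 => (m ξ : ℂ)) x := by
  have heven := hm.fourierInv_isometry (LinearIsometryEquiv.neg ℝ) x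
  apply Complex.conj_eq_iff_re.1
  conv_rhs => rw [← heven]
  rw [Real.fourierInv_eq, Real.fourierInv_eq, ← integral_conj]
  refine integral_congr_ae (.of_forall fun ξ => ?_)
  simp [Circle.smul_def, ← Circle.coe_inv_eq_conj, AddChar.map_neg_eq_inv]

theorem IsSymbol.fourierInv_schwartz_apply (hm : IsSymbol m) (x : E3) :
    𝓕⁻ hm.schwartz x = (kernel m x : ℂ) := by
  rw [hm.ofReal_kernel, SchwartzMap.fourierInv_coe]
  rfl

theorem IsSymbol.rapidDecay_kernel (hm : IsSymbol m) : RapidDecay (kernel m) := by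
  convert RapidDecay.re_schwartzMap (𝓕⁻ hm.schwartz) using 2 with x
  rw [hm.fourierInv_schwartz_apply, Complex.ofReal_re]

theorem IsSymbol.fourier_kernel (hm : IsSymbol m) (ξ : E3) :
    𝓕 (fun x => (kernel m x : ℂ)) ξ = (m ξ : ℂ) := by
  have hcoe : (fun x => (kernel m x : ℂ)) = ⇑(𝓕⁻ hm.schwartz : SchwartzMap E3 ℂ) :=
    funext fun x => (hm.fourierInv_schwartz_apply x).symm
  rw [hcoe, ← SchwartzMap.fourier_coe, FourierTransform.fourier_fourierInv_eq, hm.schwartz_apply]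

theorem IsSymbol.integral_kernel (hm : IsSymbol m) : ∫ x, kernel m x = m 0 := by
  have hzero := hm.fourier_kernel 0
  simp only [Real.fourier_eq, inner_zero_right, neg_zero, AddChar.map_zero_eq_one, one_smul]
    at hzero
  rw [integral_complex_ofReal] at hzero
  exact_mod_cast hzero

theorem IsSymbol.contDiff_kernel (hm : IsSymbol m) : ContDiff ℝ ∞ (kernel m) := by
  have hre : kernel m = fun x => Complex.reCLM (𝓕⁻ hm.schwartz x) := by
    ext x
    rw [hm.fourierInv_schwartz_apply, Complex.reCLM_apply, Complex.ofReal_re]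
  rw [hre]
  exact Complex.reCLM.contDiff.comp ((𝓕⁻ hm.schwartz : SchwartzMap E3 ℂ).smooth _)

theorem IsSymbol.differentiable_kernel (hm : IsSymbol m) : Differentiable ℝ (kernel m) :=
  hm.contDiff_kernel.differentiable (by simp)

theorem IsSymbol.lineDerivOp_fourierInv_schwartz_apply (hm : IsSymbol m) (e x : E3) :
    ∂_{e} (𝓕⁻ hm.schwartz) x = (fderiv ℝ (kernel m) x e : ℂ) := by
  have hcoe : ⇑(𝓕⁻ hm.schwartz : SchwartzMap E3 ℂ) = Complex.ofRealCLM ∘ kernel m :=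
    funext hm.fourierInv_schwartz_apply
  have hcomp := Complex.ofRealCLM.hasFDerivAt.comp x (hm.differentiable_kernel x).hasFDerivAt
  rw [SchwartzMap.lineDerivOp_apply_eq_fderiv, hcoe, hcomp.fderiv]
  rfl

theorem IsSymbol.evenKernel (hm : IsSymbol m) (e : E3) : EvenKernel e (kernel m) where
  differentiable := hm.differentiable_kernel
  rapidDecay := hm.rapidDecay_kernel
  rapidDecay_fderiv := by
    convert RapidDecay.re_schwartzMap (∂_{e} (𝓕⁻ hm.schwartz)) using 2 with x
    rw [hm.lineDerivOp_fourierInv_schwartz_apply, Complex.ofReal_re]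
  even x := by rw [kernel, hm.fourierInv_isometry, kernel]

/-- The symbol of the derivative in the direction `e` of the kernel of `m`. -/
def derivSymbol (e : E3) (m : E3 → ℝ) (ξ : E3) : ℂ :=
  2 * Real.pi * Complex.I * (inner ℝ ξ e * m ξ)

theorem IsSymbol.derivSymbol_eq (hm : IsSymbol m) (e : E3) :
    derivSymbol e m = ⇑((2 * Real.pi * Complex.I : ℂ) •
      SchwartzMap.smulLeftCLM ℂ (fun ξ : E3 => inner ℝ ξ e) hm.schwartz) := by
  ext ξ
  have htemp : (fun ξ : E3 => inner ℝ ξ e).HasTemperateGrowth := by fun_prop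
  rw [smul_apply, SchwartzMap.smulLeftCLM_apply_apply htemp, hm.schwartz_apply]
  simp [derivSymbol]

theorem IsSymbol.ofReal_fderiv_kernel (hm : IsSymbol m) (e x : E3) :
    (fderiv ℝ (kernel m) x e : ℂ) = 𝓕⁻ (derivSymbol e m) x := by
  rw [← hm.lineDerivOp_fourierInv_schwartz_apply, SchwartzMap.lineDerivOp_fourierInv_eq,
    SchwartzMap.fourierInv_coe, hm.derivSymbol_eq]

theorem IsSymbol.integrable_derivSymbol (hm : IsSymbol m) (e : E3) :
    Integrable (derivSymbol e m) := by
  rw [hm.derivSymbol_eq]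
  exact SchwartzMap.integrable _

theorem kernel_zero : kernel 0 = 0 := by
  ext x
  simp [kernel, Real.fourierInv_eq]

theorem IsSymbol.kernel_sub (hm : IsSymbol m) (hμ : IsSymbol μ) :
    kernel (m - μ) = kernel m - kernel μ := by
  have hint {m : E3 → ℝ} (hm : IsSymbol m) (x : E3) :
      Integrable fun ξ => Real.fourierChar (inner ℝ ξ x) • (m ξ : ℂ) := by
    simpa using (Real.fourierIntegral_convergent_iff (-x)).2 hm.integrable_ofReal
  ext x
  simp only [kernel, Pi.sub_apply, Real.fourierInv_eq, Complex.ofReal_sub, smul_sub]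
  rw [integral_sub (hint hm x) (hint hμ x), Complex.sub_re]

theorem kernel_comp_inv_smul (m : E3 → ℝ) {c : ℝ} (hc : 0 < c) :
    kernel (fun ξ => m (c⁻¹ • ξ)) = dilate c (kernel m) := by
  ext x
  have hdil := Measure.integral_comp_inv_smul (volume : Measure E3)
    (fun ξ => Real.fourierChar (inner ℝ ξ (c • x)) • (m ξ : ℂ)) c
  have hinner (ξ : E3) : inner ℝ (c⁻¹ • ξ) (c • x) = inner ℝ ξ x := by
    rw [real_inner_smul_left, real_inner_smul_right, inv_mul_cancel_left₀ hc.ne']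
  simp only [hinner] at hdil
  rw [dilate, kernel, kernel, Real.fourierInv_eq, Real.fourierInv_eq, hdil,
    abs_of_pos (pow_pos hc _), Complex.smul_re, smul_eq_mul]

theorem OddAlong.kernel_convolution_sq_div_eq_zero {e : E3} {M : ℝ} {u : E3 → ℝ}
    (hu : OddAlong e M u) (he : ‖e‖ = 1) (hm : IsSymbol m) (hμ : IsSymbol μ)
    (h : ∀ t ∈ Set.Ioc (0 : ℝ) 1, ∀ ξ η, m ξ ≠ 0 → m η ≠ 0 → μ (stretch e t ξ + η) = 0) (x : E3) :
    (kernel μ ⋆ fun v => (kernel m ⋆ u) v ^ 2 / inner ℝ e v) x = 0 := by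
  refine hu.convolution_convolution_sq_div_eq_zero (hm.evenKernel e) hμ.rapidDecay_kernel he x
    fun t ht w w' => ?_
  have hK : Integrable fun x => (kernel μ x : ℂ) := hμ.rapidDecay_kernel.integrable.ofReal
  have hzero := integral_mul_fourierInv_comp_mul_fourierInv_eq_zero hK
    (hm.integrable_derivSymbol e) hm.integrable_ofReal (stretch e t) x w w' fun ξ η hξ hη => by
      rw [adjoint_stretch, hμ.fourier_kernel,
        h t ht ξ η (fun h0 => hξ (by simp [derivSymbol, h0])) (by exact_mod_cast hη),
        Complex.ofReal_zero]
  simp only [← hm.ofReal_fderiv_kernel, ← hm.ofReal_kernel, ← Complex.ofReal_mul] at hzero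
  simp only [mul_assoc]
  exact_mod_cast integral_complex_ofReal.symm.trans hzero

end Symbols

section DyadicTelescoping

theorem abs_sq_div_le {a l D : ℝ} (ha : |a| ≤ D * |l|) : |a ^ 2 / l| ≤ D ^ 2 * |l| := by
  rcases eq_or_ne l 0 with rfl | hl
  · simp
  rw [abs_div, abs_pow, div_le_iff₀ (abs_pos.2 hl)]
  calc |a| ^ 2 ≤ (D * |l|) ^ 2 := by gcongr
    _ = D ^ 2 * |l| * |l| := by ring

theorem abs_sq_div_sub_sq_div_le {a b l D : ℝ} (hD : 0 ≤ D) (ha : |a| ≤ D * |l|)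
    (hb : |b| ≤ D * |l|) : |b ^ 2 / l - a ^ 2 / l| ≤ 2 * D * |b - a| := by
  rcases eq_or_ne l 0 with rfl | hl
  · simpa using by positivity
  rw [← sub_div, abs_div, div_le_iff₀ (abs_pos.2 hl), sq_sub_sq, abs_mul]
  calc |b + a| * |b - a| ≤ (D * |l| + D * |l|) * |b - a| := by
        gcongr
        exact (abs_add_le b a).trans (add_le_add hb ha)
    _ = 2 * D * |b - a| * |l| := by ring

variable (P : DyadicPartition)

theorem DyadicPartition.isSymbol_χ : IsSymbol P.χ := ⟨P.χ_smooth, P.χ_compact, P.χ_radial⟩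

theorem DyadicPartition.isSymbol_φ : IsSymbol P.φ := ⟨P.φ_smooth, P.φ_compact, P.φ_radial⟩

theorem DyadicPartition.χ_zero : P.χ 0 = 1 := by
  have hsum := P.sum_inhom 0
  have hφ : P.φ 0 = 0 := image_eq_zero_of_notMem_tsupport P.φ_away
  simp only [smul_zero, hφ] at hsum
  linarith [hsum.unique hasSum_zero]

theorem DyadicPartition.φ_eq_χ_sub (η : E3) : P.φ η = P.χ ((2 : ℝ)⁻¹ • η) - P.χ η := by
  have htail := (hasSum_nat_add_iff' 1).2 (P.sum_inhom η)
  have hshift : (fun q : ℕ => P.φ ((2 : ℝ) ^ (-((q + 1 : ℕ) : ℤ)) • η)) =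
      fun q : ℕ => P.φ ((2 : ℝ) ^ (-(q : ℤ)) • (2 : ℝ)⁻¹ • η) := by
    ext q
    rw [smul_smul, ← zpow_neg_one, ← zpow_add₀ (by norm_num)]
    congr 3
    push_cast
    ring
  rw [hshift] at htail
  have huniq := (P.sum_inhom ((2 : ℝ)⁻¹ • η)).unique htail
  simp only [Finset.range_one, Finset.sum_singleton, Nat.cast_zero, neg_zero, zpow_zero,
    one_smul] at huniq
  linarith

/-- The symbols of the low frequency cut-offs. The index is shifted by one, so that
`lowSymbol P (n + 1)` cuts off at frequency `2 ^ n` and the sequence starts from `0`. -/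
def DyadicPartition.lowSymbol : ℕ → E3 → ℝ
  | 0 => 0
  | n + 1 => fun ξ => P.χ (((2 : ℝ) ^ n)⁻¹ • ξ)

/-- The symbol of the dyadic block `Δ_{n-1}`. -/
def DyadicPartition.blockSymbol (n : ℕ) : E3 → ℝ := P.lowSymbol (n + 1) - P.lowSymbol n

theorem DyadicPartition.isSymbol_lowSymbol : ∀ n, IsSymbol (P.lowSymbol n)
  | 0 => .zero
  | _ + 1 => (P.isSymbol_χ).comp_smul (by positivity)

theorem DyadicPartition.isSymbol_blockSymbol (n : ℕ) : IsSymbol (P.blockSymbol n) :=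
  (P.isSymbol_lowSymbol (n + 1)).sub (P.isSymbol_lowSymbol n)

theorem DyadicPartition.kernel_lowSymbol_succ (n : ℕ) :
    kernel (P.lowSymbol (n + 1)) = dilate (2 ^ n) (kernel P.χ) :=
  kernel_comp_inv_smul P.χ (by positivity)

theorem DyadicPartition.blockSymbol_zero : P.blockSymbol 0 = P.χ := by
  ext ξ
  simp [blockSymbol, lowSymbol]

theorem DyadicPartition.blockSymbol_succ (n : ℕ) :
    P.blockSymbol (n + 1) = fun ξ => P.φ (((2 : ℝ) ^ n)⁻¹ • ξ) := by
  ext ξ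
  rw [φ_eq_χ_sub, smul_smul, ← mul_inv_rev, ← pow_succ]
  rfl

theorem DyadicPartition.kernel_blockSymbol_succ (n : ℕ) :
    kernel (P.blockSymbol (n + 1)) = dilate (2 ^ n) (kernel P.φ) := by
  rw [blockSymbol_succ, kernel_comp_inv_smul P.φ (by positivity)]

theorem DyadicPartition.exists_eLpNorm_kernel_blockSymbol_le :
    ∃ B : ℝ≥0, ∀ m, eLpNorm (kernel (P.blockSymbol m)) 1 volume ≤ B := by
  have hχ := memLp_one_iff_integrable.2 (P.isSymbol_χ).rapidDecay_kernel.integrable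
  have hφ := memLp_one_iff_integrable.2 (P.isSymbol_φ).rapidDecay_kernel.integrable
  refine ⟨(eLpNorm (kernel P.χ) 1 volume).toNNReal + (eLpNorm (kernel P.φ) 1 volume).toNNReal,
    fun m => ?_⟩
  rw [ENNReal.coe_add, ENNReal.coe_toNNReal hχ.2.ne, ENNReal.coe_toNNReal hφ.2.ne]
  cases m with
  | zero => exact P.blockSymbol_zero ▸ le_self_add
  | succ n =>
    rw [kernel_blockSymbol_succ, eLpNorm_dilate_one (by positivity)]
    exact le_add_self

theorem DyadicPartition.exists_norm_le_of_lowSymbol_ne_zero :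
    ∃ R : ℝ, 0 < R ∧ ∀ n ξ, P.lowSymbol n ξ ≠ 0 → ‖ξ‖ ≤ 2 ^ n * R := by
  obtain ⟨R, hR0, hR⟩ := P.χ_compact.isBounded.subset_closedBall_lt 0 0
  refine ⟨R, hR0, fun n ξ h => ?_⟩
  cases n with
  | zero => exact absurd rfl h
  | succ n =>
    have hmem := hR (subset_tsupport _ h)
    rw [mem_closedBall_zero_iff, norm_smul, norm_inv, norm_pow, Real.norm_ofNat,
      inv_mul_le_iff₀ (by positivity)] at hmem
    refine hmem.trans ?_
    gcongr
    · norm_num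
    · exact n.le_succ

theorem DyadicPartition.exists_blockSymbol_eq_zero : ∃ N : ℕ, ∀ n m : ℕ, n + N < m → ∀ ξ η ζ : E3,
    P.lowSymbol n ξ ≠ 0 → P.lowSymbol n η ≠ 0 → ‖ζ‖ ≤ ‖ξ‖ + ‖η‖ → P.blockSymbol m ζ = 0 := by
  obtain ⟨R, -, hR⟩ := P.exists_norm_le_of_lowSymbol_ne_zero
  obtain ⟨ε, hε, hφ⟩ := Metric.isOpen_iff.1 (isClosed_tsupport P.φ).isOpen_compl 0 P.φ_away
  obtain ⟨N, hN⟩ := pow_unbounded_of_one_lt (2 * R / ε) (by norm_num : (1 : ℝ) < 2)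
  rw [div_lt_iff₀ hε] at hN
  refine ⟨N, fun n m hm ξ η ζ hξ hη hζ => ?_⟩
  obtain ⟨k, rfl⟩ : ∃ k, m = n + N + k + 1 := Nat.exists_eq_add_of_lt hm
  rw [blockSymbol_succ]
  refine image_eq_zero_of_notMem_tsupport (hφ ?_)
  rw [mem_ball_zero_iff, norm_smul, norm_inv, norm_pow, Real.norm_ofNat,
    inv_mul_lt_iff₀ (by positivity)]
  calc ‖ζ‖ ≤ 2 ^ n * (2 * R) := by linarith [hR n ξ hξ, hR n η hη]
    _ < 2 ^ n * (2 ^ N * ε) := by gcongr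
    _ ≤ 2 ^ n * (2 ^ N * ε) * 2 ^ k := le_mul_of_one_le_right (by positivity)
        (one_le_pow₀ (by norm_num))
    _ = 2 ^ (n + N + k) * ε := by ring

theorem DyadicPartition.tendsto_lowSymbol_convolution {u : E3 → ℝ} (hu : LinearGrowth u)
    (huc : Continuous u) (x : E3) :
    Tendsto (fun n => (kernel (P.lowSymbol n) ⋆ u) x) atTop (𝓝 (u x)) := by
  have hlim := ((P.isSymbol_χ).rapidDecay_kernel.tendsto_dilate_convolution hu huc x).comp
    (tendsto_pow_atTop_atTop_of_one_lt (by norm_num : (1 : ℝ) < 2))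
  rw [(P.isSymbol_χ).integral_kernel, χ_zero, one_smul] at hlim
  rw [← tendsto_add_atTop_iff_nat 1]
  simpa only [kernel_lowSymbol_succ, Function.comp_def] using hlim

variable {e : E3} {M : ℝ} {u : E3 → ℝ}

theorem DyadicPartition.exists_abs_lowSymbol_convolution_le (he : ‖e‖ = 1) :
    ∃ C : ℝ, 0 ≤ C ∧ ∀ (M : ℝ) (u : E3 → ℝ), OddAlong e M u → ∀ n x,
      |(kernel (P.lowSymbol n) ⋆ u) x| ≤ C * M * |inner ℝ e x| := by
  obtain ⟨C, hC, h⟩ := ((P.isSymbol_χ).evenKernel e).exists_abs_dilate_convolution_le he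
  refine ⟨C, hC, fun M u hu n x => ?_⟩
  cases n with
  | zero =>
    have hM := hu.nonneg
    rw [lowSymbol, kernel_zero, zero_convolution, Pi.zero_apply, abs_zero]
    positivity
  | succ n => exact P.kernel_lowSymbol_succ n ▸ h (2 ^ n) M u (by positivity) hu x

theorem DyadicPartition.blockSymbol_convolution (hu : LinearGrowth u) (n : ℕ) :
    kernel (P.blockSymbol n) ⋆ u =
      kernel (P.lowSymbol (n + 1)) ⋆ u - kernel (P.lowSymbol n) ⋆ u := by
  rw [blockSymbol, (P.isSymbol_lowSymbol _).kernel_sub (P.isSymbol_lowSymbol _)]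
  exact (P.isSymbol_lowSymbol _).rapidDecay_kernel.sub_convolution
    (P.isSymbol_lowSymbol _).rapidDecay_kernel hu

/-- The approximation of `u ^ 2 / ⟪e, y⟫` by low frequencies of `u`, indexed as
`DyadicPartition.lowSymbol`. -/
def lowSquare (e : E3) (u : E3 → ℝ) (n : ℕ) (y : E3) : ℝ :=
  (kernel (P.lowSymbol n) ⋆ u) y ^ 2 / inner ℝ e y

theorem lowSquare_zero : lowSquare P e u 0 = 0 := by
  ext y
  simp [lowSquare, DyadicPartition.lowSymbol, kernel_zero]

variable {P} {D : ℝ}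

theorem linearGrowth_lowSquare (he : ‖e‖ = 1) (hu : LinearGrowth u) {n : ℕ}
    (h : ∀ x, |(kernel (P.lowSymbol n) ⋆ u) x| ≤ D * |inner ℝ e x|) :
    LinearGrowth (lowSquare P e u n) := by
  have hlow := ((P.isSymbol_lowSymbol n).rapidDecay_kernel.linearGrowth_convolution hu).1
  have hinner : AEStronglyMeasurable (fun y : E3 => inner ℝ e y) volume :=
    Continuous.aestronglyMeasurable (by fun_prop)
  exact .of_norm_le_inner ((hlow.aemeasurable.pow_const 2).div
    hinner.aemeasurable).aestronglyMeasurable (sq_nonneg D) he fun y => abs_sq_div_le (h y)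

theorem eLpNorm_lowSquare_succ_sub_le (hD : 0 ≤ D) (hu : LinearGrowth u)
    (h : ∀ n x, |(kernel (P.lowSymbol n) ⋆ u) x| ≤ D * |inner ℝ e x|) (p : ℝ≥0∞) (n : ℕ) :
    eLpNorm (lowSquare P e u (n + 1) - lowSquare P e u n) p volume ≤
      ENNReal.ofReal (2 * D) * eLpNorm (kernel (P.blockSymbol n) ⋆ u) p volume := by
  refine eLpNorm_le_mul_eLpNorm_of_ae_le_mul (.of_forall fun y => ?_) p
  rw [P.blockSymbol_convolution hu]
  exact abs_sq_div_sub_sq_div_le hD (h n y) (h (n + 1) y)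

theorem tendsto_convolution_lowSquare {K : E3 → ℝ} (hK : RapidDecay K) (he : ‖e‖ = 1)
    (hu : LinearGrowth u) (huc : Continuous u)
    (h : ∀ n x, |(kernel (P.lowSymbol n) ⋆ u) x| ≤ D * |inner ℝ e x|) (x : E3) :
    Tendsto (fun n => (K ⋆ lowSquare P e u n) x) atTop
      (𝓝 ((K ⋆ fun y => u y ^ 2 / inner ℝ e y) x)) := by
  have hbound : LinearGrowth fun y => D ^ 2 * |inner ℝ e y| :=
    .of_norm_le_inner (Continuous.aestronglyMeasurable (by fun_prop)) (sq_nonneg D) he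
      fun y => (Real.norm_of_nonneg (by positivity)).le
  have hg (n : ℕ) := hK.convolutionExists (linearGrowth_lowSquare he hu (h n)) x
  refine tendsto_integral_of_dominated_convergence _
    (fun n => (hg n).aestronglyMeasurable) (hK.convolutionExists hbound x).norm
    (fun n => .of_forall fun z => ?_) (.of_forall fun z => ?_)
  · simp only [ContinuousLinearMap.lsmul_apply, norm_smul]
    gcongr
    exact (abs_sq_div_le (h n _)).trans (le_abs_self _)
  · exact (((P.tendsto_lowSymbol_convolution hu huc _).pow 2).div_const _).const_smul (K z)

theorem OddAlong.blockSymbol_convolution_lowSquare_eq_zero (hu : OddAlong e M u) (he : ‖e‖ = 1)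
    {n m : ℕ} (h : ∀ ξ η ζ : E3, P.lowSymbol n ξ ≠ 0 → P.lowSymbol n η ≠ 0 → ‖ζ‖ ≤ ‖ξ‖ + ‖η‖ →
      P.blockSymbol m ζ = 0) :
    kernel (P.blockSymbol m) ⋆ lowSquare P e u n = 0 := by
  ext x
  refine hu.kernel_convolution_sq_div_eq_zero he (P.isSymbol_lowSymbol n)
    (P.isSymbol_blockSymbol m) (fun t ht ξ η hξ hη => h ξ η _ hξ hη ?_) x
  refine (norm_add_le _ _).trans ?_
  gcongr
  exact norm_stretch_le he (abs_le.2 ⟨by linarith [ht.1], ht.2⟩) ξ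

theorem DyadicPartition.exists_eLpNorm_blockSymbol_convolution_sq_div_le (P : DyadicPartition)
    (he : ‖e‖ = 1) :
    ∃ (N : ℕ) (C : ℝ≥0), ∀ p : ℝ≥0∞, 1 ≤ p → ∀ (M : ℝ) (u : E3 → ℝ), OddAlong e M u → ∀ m : ℕ,
      eLpNorm (kernel (P.blockSymbol m) ⋆ fun y => u y ^ 2 / inner ℝ e y) p volume ≤
        C * ENNReal.ofReal M * ∑' n : ℕ, if m ≤ n + N then
          eLpNorm (kernel (P.blockSymbol n) ⋆ u) p volume else 0 := by
  obtain ⟨N, hN⟩ := P.exists_blockSymbol_eq_zero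
  obtain ⟨B, hB⟩ := P.exists_eLpNorm_kernel_blockSymbol_le
  obtain ⟨C, hC, hlow⟩ := P.exists_abs_lowSymbol_convolution_le he
  refine ⟨N + 1, B * (2 * C).toNNReal, fun p hp M u hu m => ?_⟩
  have hD : 0 ≤ C * M := mul_nonneg hC hu.nonneg
  have hlg := hu.linearGrowth he
  have hsq (n : ℕ) := linearGrowth_lowSquare he hlg (hlow M u hu n)
  have hK := (P.isSymbol_blockSymbol m).rapidDecay_kernel
  have hconst : ((B * (2 * C).toNNReal : ℝ≥0) : ℝ≥0∞) * ENNReal.ofReal M =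
      B * ENNReal.ofReal (2 * (C * M)) := by
    rw [ENNReal.coe_mul, mul_assoc, ← mul_assoc 2 C M,
      ENNReal.ofReal_mul (p := 2 * C) (by positivity)]
    rfl
  rw [hconst, ← ENNReal.tsum_mul_left]
  refine (eLpNorm_le_tsum_eLpNorm_sub
    (fun n => (hK.linearGrowth_convolution (hsq n)).1) hp
    (by rw [lowSquare_zero, convolution_zero])
    (.of_forall (tendsto_convolution_lowSquare hK he hlg hu.continuous (hlow M u hu)))).trans
    (ENNReal.tsum_le_tsum fun n => ?_)
  split_ifs with hn
  · rw [← hK.convolution_sub (hsq _) (hsq _), mul_assoc]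
    refine (eLpNorm_lsmul_convolution_le hK.continuous.aestronglyMeasurable
      ((hsq _).sub (hsq _)).1 hp).trans ?_
    gcongr
    · exact hB m
    · exact eLpNorm_lowSquare_succ_sub_le hD hlg (hlow M u hu) p n
  · rw [hu.blockSymbol_convolution_lowSquare_eq_zero he (hN (n + 1) m (by omega)),
      hu.blockSymbol_convolution_lowSquare_eq_zero he (hN n m (by omega)), sub_zero, eLpNorm_zero]
    exact zero_le

end DyadicTelescoping

section SwirlGeometry

theorem rot_periodic (x : E3) : Function.Periodic (fun α => rot α x) (2 * Real.pi) := fun α => by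
  simp only [rot, Real.cos_add_two_pi, Real.sin_add_two_pi]

theorem rot_rot_neg (α : ℝ) (v : E3) : rot α (rot (-α) v) = v := by
  have h := Real.sin_sq_add_cos_sq α
  ext j
  fin_cases j
  · simp [rot]
    linear_combination v 0 * h
  · simp [rot]
    linear_combination v 1 * h
  · simp [rot]

theorem exists_rot_eq {x y : E3} (h : x 0 ^ 2 + x 1 ^ 2 = y 0 ^ 2 + y 1 ^ 2) (h2 : x 2 = y 2) :
    ∃ α ∈ Set.Icc (0 : ℝ) (2 * Real.pi), rot α x = y := by
  set z : ℂ := ⟨x 0, x 1⟩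
  set w : ℂ := ⟨y 0, y 1⟩
  have hnorm : ‖z‖ = ‖w‖ := by
    simp only [Complex.norm_eq_sqrt_sq_add_sq, z, w, h]
  have hx0 : x 0 = ‖w‖ * Real.cos z.arg := hnorm ▸ (Complex.norm_mul_cos_arg z).symm
  have hx1 : x 1 = ‖w‖ * Real.sin z.arg := hnorm ▸ (Complex.norm_mul_sin_arg z).symm
  have hy0 : ‖w‖ * Real.cos w.arg = y 0 := Complex.norm_mul_cos_arg w
  have hy1 : ‖w‖ * Real.sin w.arg = y 1 := Complex.norm_mul_sin_arg w
  have hrot : rot (w.arg - z.arg) x = y := by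
    have harg : w.arg = w.arg - z.arg + z.arg := by ring
    ext j
    fin_cases j
    · rw [harg, Real.cos_add] at hy0
      simp [rot, hx0, hx1, ← hy0]
      ring
    · rw [harg, Real.sin_add] at hy1
      simp [rot, hx0, hx1, ← hy1]
      ring
    · simpa [rot] using h2
  obtain ⟨α, hα, hαrot⟩ := (rot_periodic x).exists_mem_Ico₀ Real.two_pi_pos (w.arg - z.arg)
  exact ⟨α, Set.Ico_subset_Icc_self hα, hαrot.symm.trans hrot⟩

theorem axisDist_sq (x : E3) : axisDist x ^ 2 = x 0 ^ 2 + x 1 ^ 2 :=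
  Real.sq_sqrt (by positivity)

theorem axisDist_eq_zero {x : E3} : axisDist x = 0 ↔ x 0 = 0 ∧ x 1 = 0 := by
  rw [axisDist, Real.sqrt_eq_zero (by positivity)]
  constructor
  · intro h
    constructor <;> nlinarith [sq_nonneg (x 0), sq_nonneg (x 1)]
  · rintro ⟨h0, h1⟩
    simp [h0, h1]

theorem ae_axisDist_ne_zero : ∀ᵐ y : E3, axisDist y ≠ 0 := by
  have hker : LinearMap.ker (EuclideanSpace.proj (𝕜 := ℝ) (0 : Fin 3) : E3 →L[ℝ] ℝ).toLinearMap
      ≠ ⊤ := fun h => by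
    simpa using (h ▸ Submodule.mem_top : (EuclideanSpace.single 0 1 : E3) ∈
      LinearMap.ker (EuclideanSpace.proj (𝕜 := ℝ) (0 : Fin 3) : E3 →L[ℝ] ℝ).toLinearMap)
  rw [ae_iff]
  refine measure_mono_null (fun y hy => ?_) (Measure.addHaar_submodule volume _ hker)
  simpa using (axisDist_eq_zero.1 (not_not.1 hy)).1

theorem swirlRatio_eq_div (b : E3 → E3) (x : E3) :
    swirlRatio b x = (x 0 * b x 1 - x 1 * b x 0) / axisDist x ^ 2 := by
  simp only [swirlRatio, angularPart, eTheta, PiLp.inner_apply, Fin.sum_univ_three]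
  simp
  ring

variable {b : E3 → E3}

theorem IsSmoothSwirl.swirlRatio_rot (hb : IsSmoothSwirl b) {α : ℝ}
    (hα : α ∈ Set.Icc 0 (2 * Real.pi)) (x : E3) :
    swirlRatio b (rot α x) = swirlRatio b x := by
  have hrot : b (rot α x) = rot α (b x) := by
    rw [← hb.axisymmetric α hα x, rot_rot_neg]
  have h := Real.sin_sq_add_cos_sq α
  rw [swirlRatio_eq_div, swirlRatio_eq_div, axisDist_sq, axisDist_sq, hrot]
  congr 1
  · simp [rot]
    linear_combination (x 0 * b x 1 - x 1 * b x 0) * h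
  · simp [rot]
    linear_combination (x 0 ^ 2 + x 1 ^ 2) * h

theorem IsSmoothSwirl.apply_two (hb : IsSmoothSwirl b) (x : E3) : b x 2 = 0 := by
  have hcont : Continuous fun y => b y 2 := by
    have := hb.smooth.continuous
    fun_prop
  exact congrFun (Continuous.ae_eq_iff_eq volume hcont continuous_const |>.1
    (ae_axisDist_ne_zero.mono hb.vertical_eq_zero)) x

-- On the axis, invariance under the half turn forces the horizontal components to vanish.
theorem IsSmoothSwirl.apply_of_axisDist_eq_zero (hb : IsSmoothSwirl b) {x : E3}
    (h : axisDist x = 0) : b x 0 = 0 ∧ b x 1 = 0 := by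
  obtain ⟨hx0, hx1⟩ := axisDist_eq_zero.1 h
  have hfix : rot Real.pi x = x := by
    ext j
    fin_cases j <;> simp [rot, hx0, hx1]
  have hinv := hb.axisymmetric Real.pi ⟨Real.pi_pos.le, by linarith [Real.pi_pos]⟩ x
  rw [hfix] at hinv
  have h0 : -b x 0 = b x 0 := by simpa [rot] using congrArg (· 0) hinv
  have h1 : -b x 1 = b x 1 := by simpa [rot] using congrArg (· 1) hinv
  constructor <;> linarith

/-- A unit vector across whose orthogonal plane the `i`-th component of a swirl is odd. The
component `2` of a swirl vanishes, so that any unit vector serves there. -/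
def swirlNormal : Fin 3 → E3 :=
  ![-EuclideanSpace.single 1 1, EuclideanSpace.single 0 1, EuclideanSpace.single 2 1]

theorem norm_swirlNormal (i : Fin 3) : ‖swirlNormal i‖ = 1 := by
  fin_cases i <;> simp [swirlNormal]

theorem IsSmoothSwirl.apply_eq_inner_mul (hb : IsSmoothSwirl b) (x : E3) {i : Fin 3}
    (hi : i ≠ 2) : b x i = inner ℝ (swirlNormal i) x * swirlRatio b x := by
  suffices h : b x 0 = -(x 1 * swirlRatio b x) ∧ b x 1 = x 0 * swirlRatio b x by
    fin_cases i
    · simpa [swirlNormal, inner_neg_left, EuclideanSpace.inner_single_left] using h.1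
    · simpa [swirlNormal, EuclideanSpace.inner_single_left] using h.2
    · exact absurd rfl hi
  by_cases haxis : axisDist x = 0
  · simp [hb.apply_of_axisDist_eq_zero haxis, swirlRatio, haxis]
  · have hradial : b x 0 * x 0 + b x 1 * x 1 = 0 := by
      have h := hb.radial_eq_zero x haxis
      simp [radialPart, eR, PiLp.inner_apply, Fin.sum_univ_three] at h
      field_simp at h
      linarith
    have hsq := axisDist_sq x
    rw [swirlRatio_eq_div]
    constructor
    · field_simp
      linear_combination b x 0 * hsq + x 0 * hradial
    · field_simp
      linear_combination b x 1 * hsq + x 1 * hradial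

theorem IsSmoothSwirl.swirlProduct_apply (hb : IsSmoothSwirl b) (x : E3) (i : Fin 3) :
    swirlProduct b x i = b x i ^ 2 / inner ℝ (swirlNormal i) x := by
  rw [swirlProduct, PiLp.smul_apply, smul_eq_mul]
  by_cases hi : i = 2
  · simp [hi, hb.apply_two]
  · rw [hb.apply_eq_inner_mul x hi]
    rcases eq_or_ne (inner ℝ (swirlNormal i) x) 0 with h | h
    · simp [h]
    · field_simp

theorem IsSmoothSwirl.swirlRatio_reflection (hb : IsSmoothSwirl b) {i : Fin 3} (hi : i ≠ 2)
    (x : E3) : swirlRatio b ((ℝ ∙ swirlNormal i)ᗮ.reflection x) = swirlRatio b x := by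
  obtain ⟨α, hα, hrot⟩ : ∃ α ∈ Set.Icc 0 (2 * Real.pi),
      rot α x = (ℝ ∙ swirlNormal i)ᗮ.reflection x := by
    rw [reflection_orthogonal_singleton_apply (norm_swirlNormal i)]
    refine exists_rot_eq ?_ ?_ <;> fin_cases i <;>
      simp [swirlNormal, inner_neg_left, EuclideanSpace.inner_single_left] at hi ⊢ <;> ring
  rw [← hrot, hb.swirlRatio_rot hα]

theorem ae_abs_le_eLpNorm_top_toReal {α : Type*} [MeasurableSpace α] {μ : Measure α} {f : α → ℝ}
    (hf : eLpNorm f ⊤ μ < ⊤) : ∀ᵐ y ∂μ, |f y| ≤ (eLpNorm f ⊤ μ).toReal := by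
  rw [eLpNorm_exponent_top] at hf ⊢
  filter_upwards [enorm_ae_le_eLpNormEssSup f μ] with y hy
  simpa using ENNReal.toReal_mono hf.ne hy

theorem IsSmoothSwirl.abs_apply_le (hb : IsSmoothSwirl b)
    (hM : eLpNorm (swirlRatio b) ⊤ volume < ⊤) (i : Fin 3) (x : E3) :
    |b x i| ≤ (eLpNorm (swirlRatio b) ⊤ volume).toReal * |inner ℝ (swirlNormal i) x| := by
  by_cases hi : i = 2
  · rw [hi, hb.apply_two, abs_zero]
    positivity
  · have hcont := hb.smooth.continuous
    refine (Measure.dense_of_ae ((ae_abs_le_eLpNorm_top_toReal hM).mono fun y hy => ?_)).induction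
      (fun y hy => hy) (isClosed_le (by fun_prop) (by fun_prop)) x
    rw [hb.apply_eq_inner_mul y hi, abs_mul, mul_comm]
    exact mul_le_mul_of_nonneg_right hy (abs_nonneg _)

theorem IsSmoothSwirl.oddAlong (hb : IsSmoothSwirl b)
    (hM : eLpNorm (swirlRatio b) ⊤ volume < ⊤) (i : Fin 3) :
    OddAlong (swirlNormal i) (eLpNorm (swirlRatio b) ⊤ volume).toReal fun y => b y i where
  continuous := by
    have := hb.smooth.continuous
    fun_prop
  nonneg := ENNReal.toReal_nonneg
  bound := hb.abs_apply_le hM i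
  odd y := by
    by_cases hi : i = 2
    · simp only [hi, hb.apply_two, neg_zero]
    · rw [hb.apply_eq_inner_mul _ hi, hb.apply_eq_inner_mul y hi, hb.swirlRatio_reflection hi,
        reflection_orthogonal_singleton_apply (norm_swirlNormal i), inner_sub_right,
        real_inner_smul_right, real_inner_self_eq_norm_sq, norm_swirlNormal]
      ring

end SwirlGeometry

section Blocks

variable (P : DyadicPartition)

theorem block_natCast_sub_one (n : ℕ) (u : E3 → E3) :
    block P ((n : ℤ) - 1) u = kernel (P.blockSymbol n) ⋆ u := by
  cases n with
  | zero =>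
    rw [P.blockSymbol_zero]
    simp [block]
  | succ n =>
    have hn : ((n + 1 : ℕ) : ℤ) - 1 = n := by push_cast; ring
    rw [hn, block, if_pos (Int.natCast_nonneg n), P.kernel_blockSymbol_succ, mul_comm 3, zpow_mul]
    simp only [zpow_natCast, zpow_ofNat]
    congr
    ext x
    rw [dilate, finrank_euclideanSpace_fin]

theorem block_of_lt {q : ℤ} (hq : q < -1) (u : E3 → E3) : block P q u = 0 := by
  rw [block, if_neg (by omega), if_neg (by omega)]

variable {P}

theorem RapidDecay.convolution_apply {ι : Type*} [Fintype ι] {k : E3 → ℝ}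
    {u : E3 → EuclideanSpace ℝ ι} (hk : RapidDecay k) (hu : ∀ i, LinearGrowth fun y => u y i)
    (x : E3) (i : ι) : (k ⋆ u) x i = (k ⋆ fun y => u y i) x :=
  eval_integral_piLp (f := fun y => k y • u (x - y)) (fun j => hk.convolutionExists (hu j) x) i

theorem eLpNorm_le_sum_eLpNorm_apply {α ι : Type*} [MeasurableSpace α] {μ : Measure α} [Fintype ι]
    {f : α → EuclideanSpace ℝ ι} {p : ℝ≥0∞} (hf : AEStronglyMeasurable f μ) (hp : 1 ≤ p) :
    eLpNorm f p μ ≤ ∑ i, eLpNorm (fun x => f x i) p μ := by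
  have hcoord (i : ι) : AEStronglyMeasurable (fun x => f x i) μ :=
    (EuclideanSpace.proj (𝕜 := ℝ) i).continuous.comp_aestronglyMeasurable hf
  have hnorm (x : α) : ‖f x‖ ≤ (∑ i, fun x => ‖f x i‖) x := by
    rw [Finset.sum_apply, EuclideanSpace.norm_eq]
    exact Real.sqrt_le_left (Finset.sum_nonneg fun i _ => norm_nonneg _) |>.2
      (Finset.sum_sq_le_sq_sum_of_nonneg fun i _ => norm_nonneg _)
  calc eLpNorm f p μ ≤ eLpNorm (∑ i, fun x => ‖f x i‖) p μ := eLpNorm_mono_real hnorm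
    _ ≤ ∑ i, eLpNorm (fun x => ‖f x i‖) p μ := eLpNorm_sum_le (fun i _ => (hcoord i).norm) hp
    _ = _ := by simp only [eLpNorm_norm]

theorem aestronglyMeasurable_convolution_prodMk {α F : Type*} [MeasurableSpace α] {μ : Measure α}
    [SFinite μ] [NormedAddCommGroup F] [NormedSpace ℝ F] {k : E3 → ℝ} (hk : Continuous k)
    {u : α → E3 → F} (hu : AEStronglyMeasurable (fun z : α × E3 => u z.1 z.2) (μ.prod volume)) :
    AEStronglyMeasurable (fun z : α × E3 => (k ⋆ u z.1) z.2) (μ.prod volume) := by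
  have hkernel : AEStronglyMeasurable (fun z : (α × E3) × E3 => k (z.1.2 - z.2))
      ((μ.prod volume).prod volume) :=
    (hk.measurable.comp (by fun_prop)).aestronglyMeasurable
  have hfield : AEStronglyMeasurable (fun z : (α × E3) × E3 => u z.1.1 z.2)
      ((μ.prod volume).prod volume) :=
    hu.comp_quasiMeasurePreserving
      (QuasiMeasurePreserving.prodMap Measure.quasiMeasurePreserving_fst (.id volume))
  simp only [convolution_lsmul_swap]
  exact (hkernel.smul hfield).integral_prod_right'

theorem aemeasurable_eLpNorm_block {μ : Measure ℝ} [SFinite μ] {b : ℝ → E3 → E3}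
    (hb : AEStronglyMeasurable (fun z : ℝ × E3 => b z.1 z.2) (μ.prod volume)) (p : ℝ≥0∞) (q : ℤ) :
    AEMeasurable (fun τ => eLpNorm (block P q (b τ)) p volume) μ := by
  rcases lt_or_ge q (-1) with hq | hq
  · simp only [block_of_lt P hq, eLpNorm_zero]
    exact aemeasurable_const
  · obtain ⟨n, rfl⟩ : ∃ n : ℕ, q = n - 1 := ⟨(q + 1).toNat, by omega⟩
    simp only [block_natCast_sub_one]
    exact aemeasurable_eLpNorm_prodMk (aestronglyMeasurable_convolution_prodMk
      (P.isSymbol_blockSymbol n).rapidDecay_kernel.continuous hb) p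

variable {b : E3 → E3}

theorem IsSmoothSwirl.eLpNorm_convolution_swirlProduct_le (hb : IsSmoothSwirl b)
    (hM : eLpNorm (swirlRatio b) ⊤ volume < ⊤) {k : E3 → ℝ} (hk : RapidDecay k) {p : ℝ≥0∞}
    (hp : 1 ≤ p) :
    eLpNorm (k ⋆ swirlProduct b) p volume ≤
      ∑ i, eLpNorm (k ⋆ fun y => b y i ^ 2 / inner ℝ (swirlNormal i) y) p volume := by
  have hcont := hb.smooth.continuous
  have hgrowth (i : Fin 3) : LinearGrowth fun y => swirlProduct b y i := by
    refine .of_norm_le_inner (Measurable.aestronglyMeasurable ?_)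
      (sq_nonneg (eLpNorm (swirlRatio b) ⊤ volume).toReal)
      (norm_swirlNormal i) fun y => ?_
    · simp only [hb.swirlProduct_apply]
      exact (Continuous.measurable (by fun_prop)).div (Continuous.measurable (by fun_prop))
    · rw [hb.swirlProduct_apply]
      exact abs_sq_div_le (hb.abs_apply_le hM i y)
  have hmeas : AEStronglyMeasurable (swirlProduct b) volume :=
    ((WithLp.measurable_toLp 2 _).comp_aemeasurable
      (aemeasurable_pi_iff.2 fun i => (hgrowth i).1.aemeasurable)).aestronglyMeasurable
  refine (eLpNorm_le_sum_eLpNorm_apply (aestronglyMeasurable_convolution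
    hk.continuous.aestronglyMeasurable hmeas) hp).trans_eq ?_
  simp only [hk.convolution_apply hgrowth, hb.swirlProduct_apply]

theorem IsSmoothSwirl.eLpNorm_blockSymbol_convolution_apply_le (hb : IsSmoothSwirl b)
    (hM : eLpNorm (swirlRatio b) ⊤ volume < ⊤) (p : ℝ≥0∞) (n : ℕ) (i : Fin 3) :
    eLpNorm (kernel (P.blockSymbol n) ⋆ fun y => b y i) p volume ≤
      eLpNorm (block P ((n : ℤ) - 1) b) p volume := by
  refine eLpNorm_mono fun x => ?_
  rw [block_natCast_sub_one,
    ← (P.isSymbol_blockSymbol n).rapidDecay_kernel.convolution_apply fun j =>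
      (hb.oddAlong hM j).linearGrowth (norm_swirlNormal j)]
  exact PiLp.norm_apply_le _ i

variable (P) in
theorem exists_eLpNorm_block_swirlProduct_le :
    ∃ (N : ℕ) (C : ℝ≥0), ∀ p : ℝ≥0∞, 1 ≤ p → ∀ b : E3 → E3, IsSmoothSwirl b →
      eLpNorm (swirlRatio b) ⊤ volume < ⊤ → ∀ q : ℤ,
      eLpNorm (block P q (swirlProduct b)) p volume ≤
        C * eLpNorm (swirlRatio b) ⊤ volume *
          ∑' k : ℕ, eLpNorm (block P (q + (k - N)) b) p volume := by
  choose N C h using fun i : Fin 3 =>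
    P.exists_eLpNorm_blockSymbol_convolution_sq_div_le (norm_swirlNormal i)
  refine ⟨Finset.univ.sup N, ∑ i, C i, fun p hp b hb hM q => ?_⟩
  rcases lt_or_ge q (-1) with hq | hq
  · rw [block_of_lt P hq, eLpNorm_zero]
    exact zero_le
  obtain ⟨m, rfl⟩ : ∃ m : ℕ, q = m - 1 := ⟨(q + 1).toNat, by omega⟩
  have htail (i : Fin 3) :
      (∑' n : ℕ, if m ≤ n + N i then
        eLpNorm (kernel (P.blockSymbol n) ⋆ fun y => b y i) p volume else 0) ≤
      ∑' k : ℕ, eLpNorm (block P ((m : ℤ) - 1 + (k - (Finset.univ.sup N : ℕ))) b) p volume := by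
    refine le_trans (ENNReal.tsum_le_tsum fun n => ?_) (tsum_ite_le_tsum_add_sub
      (fun q => eLpNorm (block P q b) p volume) m (Finset.univ.sup N))
    have hN : N i ≤ Finset.univ.sup N := Finset.le_sup (Finset.mem_univ i)
    split_ifs with hn hn'
    exacts [hb.eLpNorm_blockSymbol_convolution_apply_le hM p n i, absurd (by omega) hn', zero_le,
      zero_le]
  rw [block_natCast_sub_one, ENNReal.ofNNReal_finsetSum, Finset.sum_mul, Finset.sum_mul]
  refine (hb.eLpNorm_convolution_swirlProduct_le hM
    (P.isSymbol_blockSymbol m).rapidDecay_kernel hp).trans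
    (Finset.sum_le_sum fun i _ => (h i p hp _ _ (hb.oddAlong hM i) m).trans ?_)
  rw [ENNReal.ofReal_toReal hM.ne]
  exact mul_le_mul_right (htail i) _

variable (P) in
theorem exists_timeSpaceNorm_block_swirlProduct_le :
    ∃ (N : ℕ) (C : ℝ≥0), ∀ ρ p : ℝ≥0∞, 1 ≤ ρ → 1 ≤ p → ∀ (t : ℝ) (b : ℝ → E3 → E3),
      AEStronglyMeasurable (fun z : ℝ × E3 => b z.1 z.2)
        ((volume.restrict (Set.Ioo 0 t)).prod volume) →
      (∀ τ ∈ Set.Ioo 0 t, IsSmoothSwirl (b τ)) →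
      timeSpaceNorm t ⊤ ⊤ (fun τ => swirlRatio (b τ)) < ⊤ → ∀ q : ℤ,
      timeSpaceNorm t ρ p (fun τ => block P q (swirlProduct (b τ))) ≤
        C * timeSpaceNorm t ⊤ ⊤ (fun τ => swirlRatio (b τ)) *
          ∑' k : ℕ, timeSpaceNorm t ρ p (fun τ => block P (q + (k - N)) (b τ)) := by
  obtain ⟨N, C, h⟩ := exists_eLpNorm_block_swirlProduct_le P
  refine ⟨N, C, fun ρ p hρ hp t b hbm hb hM q => ?_⟩
  set W := timeSpaceNorm t ⊤ ⊤ fun τ => swirlRatio (b τ)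
  have hW : ∀ᵐ τ ∂volume.restrict (Set.Ioo 0 t), eLpNorm (swirlRatio (b τ)) ⊤ volume ≤ W :=
    ae_le_eLpNormEssSup
  have hmeas (k : ℕ) := aemeasurable_eLpNorm_block (P := P) hbm p (q + (k - N))
  refine (eLpNorm_le_mul_eLpNorm_of_ae_le_mul'' (c := C * W)
    (g := fun τ => ∑' k : ℕ, eLpNorm (block P (q + (k - N)) (b τ)) p volume) ρ
    (AEMeasurable.tsum hmeas).aestronglyMeasurable ?_).trans ?_
  · filter_upwards [hW, ae_restrict_mem measurableSet_Ioo] with τ hτW hτ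
    refine (h p hp (b τ) (hb τ hτ) (hτW.trans_lt hM) q).trans ?_
    rw [enorm_eq_self]
    gcongr
  · gcongr
    exact eLpNorm_tsum_le hmeas hρ

end Blocks

theorem propositionA1_general (P : DyadicPartition) {s : ℝ} (hs : 0 < s) :
    ∃ C : ℝ≥0,
      (∀ ρ p r : ℝ≥0∞, 1 ≤ ρ → 1 ≤ p → 1 ≤ r → ∀ (t : ℝ) (b : ℝ → E3 → E3),
        AEStronglyMeasurable (fun z : ℝ × E3 => b z.1 z.2)
          ((volume.restrict (Set.Ioo 0 t)).prod volume) →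
        (∀ τ ∈ Set.Ioo 0 t, IsSmoothSwirl (b τ)) →
        timeSpaceNorm t ⊤ ⊤ (fun τ => swirlRatio (b τ)) < ⊤ →
        cheminLernerNorm P t ρ s p r (fun τ => swirlProduct (b τ)) ≤
          C * timeSpaceNorm t ⊤ ⊤ (fun τ => swirlRatio (b τ)) * cheminLernerNorm P t ρ s p r b) ∧
      (∀ p r : ℝ≥0∞, 1 ≤ p → 1 ≤ r → ∀ b : E3 → E3, IsSmoothSwirl b →
        eLpNorm (swirlRatio b) ⊤ volume < ⊤ →
        besovNorm P s p r (swirlProduct b) ≤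
          C * eLpNorm (swirlRatio b) ⊤ volume * besovNorm P s p r b) := by
  obtain ⟨N, C, hspace⟩ := exists_eLpNorm_block_swirlProduct_le P
  obtain ⟨N', C', htime⟩ := exists_timeSpaceNorm_block_swirlProduct_le P
  obtain ⟨D, hD⟩ := exists_eLpNorm_two_rpow_mul_le hs N
  obtain ⟨D', hD'⟩ := exists_eLpNorm_two_rpow_mul_le hs N'
  refine ⟨D' * C' + D * C, fun ρ p r hρ hp hr t b hbm hb hM => ?_, fun p r hp hr b hb hM => ?_⟩
  · refine (hD' r hr _ _ (fun q => timeSpaceNorm t ρ p fun τ => block P q (b τ))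
      (htime ρ p hρ hp t b hbm hb hM)).trans ?_
    rw [← mul_assoc, ← ENNReal.coe_mul]
    gcongr
    · exact le_self_add
    · exact le_rfl
  · refine (hD r hr _ _ (fun q => eLpNorm (block P q b) p volume) (hspace p hp b hb hM)).trans ?_
    rw [← mul_assoc, ← ENNReal.coe_mul]
    gcongr
    · exact le_add_self
    · exact le_rfl

end AxisymmetricProduct

end

open AxisymmetricProduct in
theorem propositionA1 (P : DyadicPartition) :
    (∀ s : ℝ, 0 < s → ∃ C : ℝ≥0, ∀ t : ℝ, 0 < t → ∀ b : ℝ → E3 → E3,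
      AEStronglyMeasurable (fun z : ℝ × E3 => b z.1 z.2)
        ((volume.restrict (Set.Ioo 0 t)).prod volume) →
      (∀ τ ∈ Set.Ioo 0 t, IsSmoothSwirl (b τ)) →
      timeSpaceNorm t ⊤ ⊤ (fun τ => swirlRatio (b τ)) < ⊤ →
      cheminLernerNorm P t 1 s 2 2 (fun τ => swirlProduct (b τ)) ≤
        C * timeSpaceNorm t ⊤ ⊤ (fun τ => swirlRatio (b τ)) * cheminLernerNorm P t 1 s 2 2 b) ∧
    (∀ p : ℝ≥0∞, 1 ≤ p → ∃ C : ℝ≥0, ∀ b : E3 → E3,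
      IsSmoothSwirl b →
      eLpNorm (swirlRatio b) ⊤ volume < ⊤ →
      besovNorm P (3 * p⁻¹.toReal + 1) p 1 (swirlProduct b) ≤
        C * eLpNorm (swirlRatio b) ⊤ volume * besovNorm P (3 * p⁻¹.toReal + 1) p 1 b) := by
  refine ⟨fun s hs => ?_, fun p hp => ?_⟩
  · obtain ⟨C, hC, -⟩ := propositionA1_general P hs
    exact ⟨C, fun t _ b => hC 1 2 2 le_rfl one_le_two one_le_two t b⟩
  · obtain ⟨C, -, hC⟩ := propositionA1_general P (s := 3 * p⁻¹.toReal + 1) (by positivity)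
    exact ⟨C, hC p 1 hp le_rfl⟩
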